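/- **Setting.** Let $D\subseteq\mathbb R$ be a Borel set and $K:D\times D\to\mathbb R$ a measurable reproducing kernel with anchor $c\in D$, i.e. $K(c,c)=0$. Let $\rho$ be a probability measure on $D$ with $M:=\int_D K(x,x)\,\rho(dx)<\infty$ and $C_0:=\int_D\int_D K(x,y)\,\rho(dx)\rho(dy)>0$. For a finite set $u$ of coordinates put $K_u(x,y)=\prod_{j\in u}K(x_j,y_j)$ and $H_u=H(K_u)$, the reproducing kernel Hilbert space with kernel $K_u$. Let $\gamma=(\gamma_u)$, $u\subset\mathbb N$ finite, be non-negative weights with $\sum_u\gamma_uM^{|u|}<\infty$ and with $\gamma_u>0$ for at least one $u\neq\emptyset$; let $\mathcal A=\{u:\gamma_u>0\}$. Let $\mathcal H_\gamma$ be the reproducing kernel Hilbert space with kernel $\sum_u\gamma_uK_u$ on $\mathcal X=\{x\in D^{\mathbb N}:\sum_u\gamma_u\prod_{j\in u}K(x_j,x_j)<\infty\}$, and let $I(f)=\int_{\mathcal X}f\,d\rho^{\mathbb N}$. For $x\in D^{\mathbb N}$ and a finite set $v$ of coordinates, $(x_v;c)$ denotes the point with coordinates $x_j$ for $j\in v$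 and $c$ for $j\notin v$. Algorithms have the form $Q(f)=\sum_{i=1}^n a_if(t_i)$ with $n\ge 0$, $a_i\in\mathbb R$ and points $t_i$ of the form $(x_v;c)$, and $e(Q;\mathcal H_\gamma)=\sup_{\|f\|_{\gamma}\le1}|I(f)-Q(f)|$. Let $\$:\mathbb N_0\to[1,\infty)$ be non-decreasing. For a strictly increasing sequence $w=(w_i)$ of finite sets of coordinates, evaluating $f$ at $x$ costs $\inf\{\$(|w_i|): x_j=c\ \forall j\notin w_i\}$ (with $\inf\emptyset=\infty$). The nested cost $\mathrm{cost}_{\mathrm{nes}}(Q)$ is the infimum over all $w$ of the sum of the costs of the evaluations used by $Q$. Put $\mathrm{comp}_{\mathrm{nes}}(\varepsilon)=\inf\{\mathrm{cost}_{\mathrm{nes}}(Q): e(Q;\mathcal H_\gamma)\le\varepsilon\}$, and let $p^{\mathrm{nes}}$ be the infimum of all $p\ge0$ for which there is $A\ge 0$ with $\mathrm{comp}_{\mathrm{nes}}(\varepsilon)\le A\varepsilon^{-p}$ for all $\varepsilon>0$ ($p^{\mathrm{nes}}=\infty$ if there is no such $p$). Put $\widehat\gamma_u=\gamma_uC_0^{|u|}$,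 and let $u_1,u_2,\dots$ be the distinct non-empty sets in $\mathcal A$, ordered such that $\widehat\gamma_{u_1}\ge\widehat\gamma_{u_2}\ge\cdots$. Let $\mathrm{decay}_\gamma=\sup\{p\in\mathbb R:\lim_{j\to\infty}\widehat\gamma_{u_j}j^p=0\}\in[0,\infty]$; if $\mathcal A$ is finite, then missing terms are read as $0$, so that $\mathrm{decay}_\gamma=\infty$. **Theorem.** Let $\$(k)=O(k^s)$ for some $s\ge0$ and let $\mathrm{decay}_\gamma>1$. Let $\gamma$ have finite algorithmic dimension: for a family $\mathcal W\supseteq\mathcal A$ of finite subsets of $\mathbb N$ and some $d\in\mathbb N$ there is a map $\phi:\mathbb N\to\{1,\dots,d\}$ that is injective on every $u\in\mathcal W$; fix such $\mathcal W$, $d$ and $\phi$. Let $\alpha>0$, let $\kappa,C,\beta_1,\beta_2\ge0$, and for every $n\ge1$ let $Q_n(f)=\sum_{i=1}^na^{(n)}_if(t^{(i,n)})$ with $a_i^{(n)}\in\mathbb R$ and $t^{(i,n)}\in D^d$ be a quadrature whose worst case error for integration over $H_u$, with $H_u$ regarded as a space of functions on $D^d$, satisfies $$e(Q_n;H_u)\le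 \kappa\,C^{|u|}(n+1)^{-\alpha}\bigl(1+\ln(n+1)\bigr)^{\beta_1|u|+\beta_2}\qquad\text{for all }u\subseteq\{1,\dots,d\}.$$ For finite $v\subset\mathbb N$ put $Q^{\mathcal W}_{n,v}(f)=\sum_{i=1}^na_i^{(n)}f(t^{(i,n)}_{\infty,v};c)$, where the $j$-th coordinate of $t^{(i,n)}_\infty$ is $t^{(i,n)}_{\phi(j)}$. Let $L\in\mathbb N$ and $a>1$, put $L_k=L\lceil a^{k-1}\rceil$, $v_0=\emptyset$ and $v_k=\bigcup_{j\le L_k}u_j$, and consider the multilevel algorithms $$Q^{\mathrm{ML}}_m(f)=f(c,c,\dots)+\sum_{k=1}^mQ^{\mathcal W}_{n_k,v_k}\bigl(f-f((\cdot)_{v_{k-1}};c)\bigr),\qquad n_1\ge n_2\ge\dots\ge n_m\ge1.$$ Then for every real $p>\max\bigl\{\frac1\alpha,\frac{2s}{\mathrm{decay}_\gamma-1}\bigr\}$ there is a constant $A>0$ such that for every $\varepsilon\in(0,1]$ one can choose $m$ and $n_1\ge\dots\ge n_m\ge1$ with $e(Q^{\mathrm{ML}}_m;\mathcal H_\gamma)\le\varepsilon$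 and $\mathrm{cost}_{\mathrm{nes}}(Q^{\mathrm{ML}}_m)\le A\,\varepsilon^{-p}$. Consequently $$p^{\mathrm{nes}}\le\max\Bigl\{\frac1\alpha,\frac{2s}{\mathrm{decay}_\gamma-1}\Bigr\},$$ where $2s/\infty=0$. -/

import Mathlib

open MeasureTheory Filter Topology
open scoped ENNReal NNReal

noncomputable section

namespace InfDimIntegration

/-! ### Reproducing kernel Hilbert spaces with real kernels -/

/-- A real-valued kernel, regarded as a kernel whose values are operators on `ℝ`. -/
def opKernel {X : Type} (k : X → X → ℝ) : Matrix X X (ℝ →L[ℝ] ℝ) :=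
  Matrix.of fun x y => k x y • ContinuousLinearMap.id ℝ ℝ

theorem opKernel_posSemidef {X : Type} {k : X → X → ℝ} (h : (Matrix.of k).PosSemidef) :
    (opKernel k).PosSemidef := by
  have hs : ∀ x y, k y x = k x y := fun x y => by simpa using h.1.apply x y
  have ht := (RKHS.posSemidef_tfae (K := opKernel k)).out 0 2
  rw [ht]
  refine ⟨?_, fun v => ?_⟩
  · refine Matrix.IsHermitian.ext fun x y => ?_
    ext
    simp [opKernel, hs x y, show ContinuousLinearMap.id ℝ ℝ = 1 from rfl]
  · have h2 := h.2 v
    rw [Finsupp.sum_comm] at h2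
    simp only [opKernel, Matrix.of_apply, star_trivial] at h2 ⊢
    simpa [mul_comm, mul_assoc, mul_left_comm] using h2

instance {X : Type} (k : X → X → ℝ) [h : Fact (Matrix.of k).PosSemidef] :
    Fact (opKernel k).PosSemidef := ⟨opKernel_posSemidef h.out⟩

/-- The reproducing kernel Hilbert space `H(k)` of functions on `X`. -/
abbrev HilbertOf {X : Type} (k : X → X → ℝ) [Fact (Matrix.of k).PosSemidef] : Type :=
  RKHS.OfKernel (opKernel k)

/-- `sup { |T f - Q f| : f ∈ H(k), ‖f‖ ≤ 1 }`, the worst case error over `H(k)` of the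
approximation `Q` to the functional `T`. -/
def worstCaseError {X : Type} (k : X → X → ℝ) [Fact (Matrix.of k).PosSemidef]
    (T Q : (X → ℝ) → ℝ) : ℝ≥0∞ :=
  ⨆ (f : HilbertOf k) (_ : ‖f‖ ≤ 1), ENNReal.ofReal |T f - Q f|

/-! ### Quadratures -/

/-- A quadrature `f ↦ ∑ aᵢ f(tᵢ)`, as the finite list of its pairs `(aᵢ, tᵢ)`. -/
abbrev Quadrature (X : Type) : Type := List (ℝ × X)

/-- The value `∑ aᵢ f(tᵢ)`. -/
def Quadrature.eval {X : Type} (Q : Quadrature X) (f : X → ℝ) : ℝ :=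
  (Q.map fun p => p.1 * f p.2).sum

/-! ### The univariate data -/

/-- A Borel set `D ⊆ ℝ`, a measurable reproducing kernel `K` on `D` with anchor `c`, and a
probability measure `ρ` on `D`, with `∫ K(x,x) ρ(dx) < ∞` and `0 < C₀ = ∫∫ K dρ dρ`.
(The last condition implies `K ≠ 0`.) -/
structure Univariate where
  D : Set ℝ
  measurableSet_D : MeasurableSet D
  K : D → D → ℝ
  posSemidef_K : (Matrix.of K).PosSemidef
  measurable_K : Measurable fun p : D × D => K p.1 p.2
  c : D
  K_anchor : K c c = 0
  ρ : Measure D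
  isProbabilityMeasure_ρ : IsProbabilityMeasure ρ
  integrable_diag : Integrable (fun x => K x x) ρ
  C₀_pos : 0 < ∫ x, ∫ y, K x y ∂ρ ∂ρ

namespace Univariate

variable (S : Univariate)

instance : IsProbabilityMeasure S.ρ := S.isProbabilityMeasure_ρ

/-- `M = ∫ K(x,x) ρ(dx)`. -/
def M : ℝ := ∫ x, S.K x x ∂S.ρ

/-- `C₀ = ∫∫ K(x,y) ρ(dx) ρ(dy)`. -/
def C₀ : ℝ := ∫ x, ∫ y, S.K x y ∂S.ρ ∂S.ρ

/-- `K_u(x,y) = ∏_{j ∈ u} K(x_j,y_j)`, a kernel on `D^ι`. -/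
def prodKernel {ι : Type} (u : Finset ι) (x y : ι → S.D) : ℝ := ∏ j ∈ u, S.K (x j) (y j)

theorem prodKernel_posSemidef {ι : Type} (u : Finset ι) :
    (Matrix.of (S.prodKernel u)).PosSemidef := by
  classical
  induction u using Finset.induction_on with
  | empty =>
    refine ⟨Matrix.IsHermitian.ext fun x y => by simp [prodKernel], fun v => ?_⟩
    have : (v.sum fun i xi => v.sum fun j xj =>
        star xi * (Matrix.of (S.prodKernel (∅ : Finset ι))) i j * xj)
        = (v.sum fun _ xi => xi) * (v.sum fun _ xj => xj) := by
      simp [prodKernel, Finsupp.sum, Finset.sum_mul_sum]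
    rw [this]
    exact mul_self_nonneg _
  | insert a u ha ih =>
    have h1 : ((Matrix.of S.K).submatrix (fun x : ι → S.D => x a) (fun x => x a)).PosSemidef :=
      S.posSemidef_K.submatrix _
    have h2 : Matrix.of (S.prodKernel (insert a u)) =
        ((Matrix.of S.K).submatrix (fun x : ι → S.D => x a) (fun x => x a)).hadamard
          (Matrix.of (S.prodKernel u)) := by
      ext x y
      simp [prodKernel, Finset.prod_insert ha]
    rw [h2]
    exact h1.hadamard ih

instance {ι : Type} (u : Finset ι) : Fact (Matrix.of (S.prodKernel u)).PosSemidef :=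
  ⟨S.prodKernel_posSemidef u⟩

/-- The worst case error `e((Q)_u; H_u)` of a `d`-dimensional quadrature `Q` for integration
over the space `H_u = H(K_u)`, `u ⊆ {1, …, d}`, whose elements are regarded as functions on `D^d`
that depend only on the coordinates in `u`. -/
def componentError {d : ℕ} (Q : Quadrature (Fin d → S.D)) (u : Finset (Fin d)) : ℝ≥0∞ :=
  worstCaseError (S.prodKernel u) (fun f => ∫ x, f x ∂(Measure.pi fun _ : Fin d => S.ρ)) Q.eval

/-- The admissible sample points `(x_v; c)`, `v` a finite set of coordinates. -/
def AdmissiblePoint : Type := {x : ℕ → S.D // {j | x j ≠ S.c}.Finite}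

/-- `(x_v; c)`: the point that agrees with `x` on `v` and has all other coordinates `c`. -/
def restrict (v : Finset ℕ) (x : ℕ → S.D) : S.AdmissiblePoint :=
  ⟨fun j => if j ∈ v then x j else S.c, v.finite_toSet.subset fun j hj => by
    by_contra h
    exact hj (if_neg (by simpa using h))⟩

/-- The algorithms `Q(f) = ∑_{i=1}^n aᵢ f(t_{vᵢ}; c)`. The zero algorithm (`n = 0`) is included. -/
abbrev Algorithm : Type := Quadrature S.AdmissiblePoint

/-! ### Cost in the nested subspace sampling model -/

/-- The cost `inf { price(|w_i|) : x_j = c for all j ∉ w_i }` of one function evaluation. -/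
def pointCost (price : ℕ → ℝ≥0) (w : ℕ → Finset ℕ) (x : S.AdmissiblePoint) : ℝ≥0∞ :=
  ⨅ (i : ℕ) (_ : ∀ j, j ∉ w i → x.1 j = S.c), (price (w i).card : ℝ≥0∞)

/-- `cost_nes(Q)`: the infimum of the total cost over all strictly increasing sequences `w`. -/
def nestedCost (price : ℕ → ℝ≥0) (Q : S.Algorithm) : ℝ≥0∞ :=
  ⨅ (w : ℕ → Finset ℕ) (_ : StrictMono w), (Q.map fun p => S.pointCost price w p.2).sum

end Univariate

/-! ### Weights and the space of functions of infinitely many variables -/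

/-- Weights: non-negative numbers `γ_u` with `∑ γ_u M^{|u|} < ∞`, and `γ_u > 0` for at least one
`u ≠ ∅`. -/
structure Weights (S : Univariate) where
  γ : Finset ℕ → ℝ
  nonneg : ∀ u, 0 ≤ γ u
  summable : Summable fun u : Finset ℕ => γ u * S.M ^ u.card
  nontrivial : ∃ u : Finset ℕ, u.Nonempty ∧ 0 < γ u

namespace Weights

variable {S : Univariate} (W : Weights S)

/-- The set `𝒜` of active coordinate sets. -/
def active : Set (Finset ℕ) := {u | 0 < W.γ u}

/-- `γ̂_u = γ_u C₀^{|u|}`. -/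
def hat (u : Finset ℕ) : ℝ := W.γ u * S.C₀ ^ u.card

/-- The domain `𝒳` of all `x ∈ D^ℕ` with `∑ γ_u ∏_{j ∈ u} K(x_j,x_j) < ∞`. -/
def domain : Set (ℕ → S.D) := {x | Summable fun u => W.γ u * S.prodKernel u x x}

/-- The kernel `∑ γ_u K_u(x,y)` on `𝒳`. -/
def kernel (x y : W.domain) : ℝ := ∑' u, W.γ u * S.prodKernel u x.1 y.1

theorem abs_le_of_posSemidef {X : Type} {k : X → X → ℝ} (h : (Matrix.of k).PosSemidef) (x y : X) :
    |k x y| ≤ k x x + k y y := by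
  classical
  have hs : k y x = k x y := by simpa using h.1.apply x y
  have hd : ∀ z, 0 ≤ k z z := fun z => h.diag_nonneg (i := z)
  by_cases hxy : x = y
  · subst hxy
    rw [abs_of_nonneg (hd x)]
    linarith [hd x]
  have key : ∀ s : ℝ, 0 ≤ k x x + 2 * s * k x y + s * s * k y y := by
    intro s
    have h2 := (h.submatrix ![x, y]).dotProduct_mulVec_nonneg ![1, s]
    simp [Matrix.mulVec, dotProduct, Fin.sum_univ_two, hs] at h2
    linarith
  rw [abs_le]
  constructor
  · linarith [key 1, hd x, hd y]
  · linarith [key (-1), hd x, hd y]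

theorem summable_kernel (x y : W.domain) :
    Summable fun u => W.γ u * S.prodKernel u x.1 y.1 := by
  refine Summable.of_norm_bounded (g := fun u => W.γ u * S.prodKernel u x.1 x.1 +
    W.γ u * S.prodKernel u y.1 y.1) (x.2.add y.2) fun u => ?_
  rw [norm_mul, Real.norm_eq_abs, Real.norm_eq_abs, abs_of_nonneg (W.nonneg u), ← mul_add]
  exact mul_le_mul_of_nonneg_left (abs_le_of_posSemidef (S.prodKernel_posSemidef u) x.1 y.1)
    (W.nonneg u)

theorem kernel_posSemidef : (Matrix.of W.kernel).PosSemidef := by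
  have hP : ∀ u : Finset ℕ, ((Matrix.of (S.prodKernel u)).submatrix
      (Subtype.val : W.domain → ℕ → S.D) Subtype.val).PosSemidef :=
    fun u => (S.prodKernel_posSemidef u).submatrix _
  refine ⟨Matrix.IsHermitian.ext fun x y => ?_, fun v => ?_⟩
  · simp only [Matrix.of_apply, star_trivial, kernel]
    refine tsum_congr fun u => ?_
    have := (S.prodKernel_posSemidef u).1.apply x.1 y.1
    simp only [Matrix.of_apply, star_trivial] at this
    rw [this]
  · have hs : HasSum (fun u : Finset ℕ => v.sum fun i xi => v.sum fun j xj =>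
        star xi * (W.γ u * S.prodKernel u i.1 j.1) * xj)
        (v.sum fun i xi => v.sum fun j xj => star xi * W.kernel i j * xj) := by
      refine hasSum_sum fun i _ => hasSum_sum fun j _ => ?_
      exact ((W.summable_kernel i j).hasSum.mul_left _).mul_right _
    refine hs.nonneg fun u => ?_
    have := ((hP u).smul (W.nonneg u)).2 v
    simpa using this

instance : Fact (Matrix.of W.kernel).PosSemidef := ⟨W.kernel_posSemidef⟩

theorem mem_domain (x : S.AdmissiblePoint) : x.1 ∈ W.domain := by
  refine summable_of_ne_finset_zero (s := x.2.toFinset.powerset) fun u hu => ?_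
  rw [Finset.mem_powerset, Finset.not_subset] at hu
  obtain ⟨j, hj, hjx⟩ := hu
  have : x.1 j = S.c := by simpa using hjx
  simp only [Univariate.prodKernel]
  rw [Finset.prod_eq_zero hj (by rw [this, S.K_anchor]), mul_zero]

/-- The admissible points lie in `𝒳`. -/
def point (x : S.AdmissiblePoint) : W.domain := ⟨x.1, W.mem_domain x⟩

/-- `I(f) = ∫_𝒳 f dμ`, where `μ` is the infinite product of `ρ`. -/
def integral (f : W.domain → ℝ) : ℝ :=
  ∫ x, f x ∂((Measure.infinitePi fun _ : ℕ => S.ρ).comap (Subtype.val : W.domain → ℕ → S.D))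

/-- The worst case error `e(Q; H(𝒦_γ))`. -/
def error (Q : S.Algorithm) : ℝ≥0∞ :=
  worstCaseError W.kernel W.integral fun f => Q.eval fun x => f (W.point x)

/-- The `ε`-complexity in the nested subspace sampling model. -/
def complexity (price : ℕ → ℝ≥0) (ε : ℝ) : ℝ≥0∞ :=
  ⨅ (Q : S.Algorithm) (_ : W.error Q ≤ ENNReal.ofReal ε), S.nestedCost price Q

/-- The exponent `p^nes` of strong tractability in the nested subspace sampling model. It is `⊤` if
integration is not strongly tractable. -/
def nestedExponent (price : ℕ → ℝ≥0) : EReal :=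
  ⨅ (p : ℝ) (_ : 0 ≤ p ∧ ∃ C : ℝ, 0 ≤ C ∧
    ∀ ε : ℝ, 0 < ε → W.complexity price ε ≤ ENNReal.ofReal (C * ε ^ (-p))), (p : EReal)

/-! ### Ordering and decay of the weights -/

/-- `u 1, u 2, …` are the distinct non-empty active sets, ordered such that
`γ̂_{u 1} ≥ γ̂_{u 2} ≥ …`, and `u 0 = ∅`. If there are only `N` non-empty active sets, then
`u j = ∅` for `j > N`. -/
structure IsOrdering (u : ℕ → Finset ℕ) : Prop where
  zero : u 0 = ∅
  mem_active : ∀ j, u j ≠ ∅ → u j ∈ W.active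
  surj : ∀ v ∈ W.active, v ≠ ∅ → ∃ j, u j = v
  inj : ∀ i j, u i ≠ ∅ → u i = u j → i = j
  anti : ∀ i j, 1 ≤ i → i ≤ j → u j ≠ ∅ → u i ≠ ∅ ∧ W.hat (u j) ≤ W.hat (u i)

theorem C₀_le_M : S.C₀ ≤ S.M := by
  have hd := S.integrable_diag
  have hnn : ∀ x, 0 ≤ S.K x x := fun x => S.posSemidef_K.diag_nonneg (i := x)
  have key : ∀ x y, S.K x y ≤ (S.K x x + S.K y y) / 2 := by
    intro x y
    have hs : S.K y x = S.K x y := by simpa using S.posSemidef_K.1.apply x y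
    have h2 := (S.posSemidef_K.submatrix ![x, y]).dotProduct_mulVec_nonneg ![1, -1]
    simp [Matrix.mulVec, dotProduct, Fin.sum_univ_two, hs] at h2
    linarith
  have hint : ∀ x, Integrable (fun y => S.K x y) S.ρ := by
    intro x
    refine Integrable.mono' ((integrable_const (S.K x x)).add hd) ?_ ?_
    · exact (S.measurable_K.comp (measurable_const.prodMk measurable_id)).aestronglyMeasurable
    · exact .of_forall fun y => abs_le_of_posSemidef S.posSemidef_K x y
  have h1 : ∀ x, ∫ y, S.K x y ∂S.ρ ≤ (S.K x x + S.M) / 2 := by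
    intro x
    have : ∫ y, S.K x y ∂S.ρ ≤ ∫ y, (S.K x x + S.K y y) / 2 ∂S.ρ :=
      integral_mono (hint x) (((integrable_const _).add hd).div_const 2) (key x)
    rw [integral_div, integral_add (integrable_const _) hd, integral_const] at this
    simpa [Univariate.M] using this
  by_cases hi : Integrable (fun x => ∫ y, S.K x y ∂S.ρ) S.ρ
  · have : S.C₀ ≤ ∫ x, (S.K x x + S.M) / 2 ∂S.ρ :=
      integral_mono hi ((hd.add (integrable_const _)).div_const 2) h1
    rw [integral_div, integral_add hd (integrable_const _), integral_const] at this
    simp only [probReal_univ, one_smul] at this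
    have h3 : S.M = ∫ x, S.K x x ∂S.ρ := rfl
    linarith
  · have : S.C₀ = 0 := integral_undef hi
    have := S.C₀_pos
    unfold Univariate.C₀ at *
    linarith

/-- An ordering of the non-empty active sets exists. -/
theorem exists_isOrdering : ∃ u, W.IsOrdering u := by
  classical
  have hsum : Summable W.hat := by
    refine Summable.of_nonneg_of_le (fun u => mul_nonneg (W.nonneg u) (pow_nonneg S.C₀_pos.le _))
      (fun u => ?_) W.summable
    exact mul_le_mul_of_nonneg_left (pow_le_pow_left₀ S.C₀_pos.le C₀_le_M _) (W.nonneg u)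
  set A : Set (Finset ℕ) := {v | v ≠ ∅ ∧ v ∈ W.active} with hA
  let key : Finset ℕ → ℝᵒᵈ ×ₗ ℕ := fun v => toLex (OrderDual.toDual (W.hat v), Encodable.encode v)
  have key_inj : ∀ v w, key v = key w → v = w := fun v w h =>
    Encodable.encode_injective (congrArg (fun z => (ofLex z).2) h)
  have key_le : ∀ v w, key v ≤ key w → W.hat w ≤ W.hat v := by
    intro v w h
    rcases (Prod.Lex.toLex_le_toLex.mp h) with h | h
    · exact (OrderDual.toDual_lt_toDual.mp h).le
    · exact (OrderDual.toDual_inj.mp h.1).ge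
  let T : Finset ℕ → Set (Finset ℕ) := fun v => {w | w ∈ A ∧ key w < key v}
  have hpos : ∀ v ∈ A, 0 < W.hat v := fun v hv => mul_pos hv.2 (pow_pos S.C₀_pos _)
  have hfin : ∀ v ∈ A, (T v).Finite := by
    intro v hv
    have h1 := hsum.tendsto_cofinite_zero.eventually (gt_mem_nhds (hpos v hv))
    refine (Filter.eventually_cofinite.mp h1).subset fun w hw => ?_
    exact not_lt.mpr (key_le w v hw.2.le)
  let r : Finset ℕ → ℕ := fun v => (T v).ncard
  have r_lt : ∀ v ∈ A, ∀ w ∈ A, key v < key w → r v < r w := by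
    intro v hv w hw h
    refine Set.ncard_lt_ncard ⟨fun x hx => ⟨hx.1, hx.2.trans h⟩, fun hs => ?_⟩ (hfin w hw)
    exact lt_irrefl _ (hs (⟨hv, h⟩ : v ∈ T w)).2
  have r_inj : ∀ v ∈ A, ∀ w ∈ A, r v = r w → v = w := by
    intro v hv w hw h
    rcases lt_trichotomy (key v) (key w) with h1 | h1 | h1
    · exact absurd h (r_lt v hv w hw h1).ne
    · exact key_inj _ _ h1
    · exact absurd h (r_lt w hw v hv h1).ne'
  have r_pred : ∀ v ∈ A, ∀ i, i < r v → ∃ w ∈ A, r w = i := by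
    intro v hv i hi
    induction hn : r v generalizing v with
    | zero => omega
    | succ n ih =>
      have hne : (T v).Nonempty := (Set.ncard_pos (hfin v hv)).mp (by change 0 < r v; omega)
      obtain ⟨w, hw, hmax⟩ := Set.exists_max_image (T v) key (hfin v hv) hne
      have hT : T w = T v \ {w} := by
        ext x
        constructor
        · exact fun hx => ⟨⟨hx.1, hx.2.trans hw.2⟩, fun h => lt_irrefl _ (h ▸ hx.2)⟩
        · rintro ⟨hx, hxw⟩
          exact ⟨hx.1, lt_of_le_of_ne (hmax x hx) fun h => hxw (key_inj _ _ h)⟩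
      have hr : r w = n := by
        change (T w).ncard = n
        rw [hT, Set.ncard_sdiff_singleton_of_mem hw]
        change r v - 1 = n
        omega
      rcases Nat.lt_or_ge i n with h | h
      · exact ih w hw.1 (by omega) hr
      · exact ⟨w, hw.1, by omega⟩
  let u : ℕ → Finset ℕ := fun j => if h : ∃ v ∈ A, r v + 1 = j then h.choose else ∅
  have u_r : ∀ v ∈ A, u (r v + 1) = v := by
    intro v hv
    have h : ∃ w ∈ A, r w + 1 = r v + 1 := ⟨v, hv, rfl⟩
    simp only [u, dif_pos h]
    exact r_inj _ h.choose_spec.1 _ hv (by have := h.choose_spec.2; omega)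
  have u_ne : ∀ j, u j ≠ ∅ → u j ∈ A ∧ r (u j) + 1 = j := by
    intro j hj
    by_cases h : ∃ v ∈ A, r v + 1 = j
    · simp only [u, dif_pos h]
      exact h.choose_spec
    · exact absurd (by simp only [u, dif_neg h]) hj
  refine ⟨u, ?_, fun j hj => (u_ne j hj).1.2, fun v hv hv0 => ⟨_, u_r v ⟨hv0, hv⟩⟩, ?_, ?_⟩
  · by_contra h
    have := (u_ne 0 h).2
    omega
  · intro i j hi hij
    have h1 := (u_ne i hi).2
    have h2 := (u_ne j (hij ▸ hi)).2
    rw [hij] at h1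
    omega
  · intro i j hi hij hj
    obtain ⟨hjA, hjr⟩ := u_ne j hj
    rcases hij.eq_or_lt with rfl | hlt
    · exact ⟨hj, le_rfl⟩
    obtain ⟨w, hw, hwr⟩ := r_pred _ hjA (i - 1) (by omega)
    have hui : u i = w := by
      have := u_r w hw
      rwa [hwr, Nat.sub_add_cancel hi] at this
    rw [hui]
    refine ⟨hw.1, key_le _ _ ?_⟩
    by_contra h
    have := r_lt _ hjA _ hw (not_le.mp h)
    omega

/-- The number `γ̂_{u j}` for `j ≥ 1`, and `0` if there is no `j`-th non-empty active set. -/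
def orderedHat (u : ℕ → Finset ℕ) (j : ℕ) : ℝ := if u j = ∅ then 0 else W.hat (u j)

/-- `decay_γ = sup { p ∈ ℝ : lim_j γ̂_{u_j} j^p = 0 }`. It is `⊤` if only finitely many sets are
active. -/
def decay (u : ℕ → Finset ℕ) : EReal :=
  ⨆ (p : ℝ) (_ : Tendsto (fun j : ℕ => W.orderedHat u j * (j : ℝ) ^ p) atTop (𝓝 0)), (p : EReal)

end Weights

/-! ### Colourings of the coordinates and multilevel algorithms -/

/-- `φ : ℕ → {1, …, d}` is injective on each of the sets in `𝒲`. The family `𝒲` has finite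
algorithmic dimension if such a `φ` exists for some finite `d`; the least such `d` is the
algorithmic dimension of `𝒲`. -/
def IsColouring (𝒲 : Set (Finset ℕ)) {d : ℕ} (φ : ℕ → Fin d) : Prop :=
  ∀ u ∈ 𝒲, Set.InjOn φ (u : Set ℕ)

namespace Univariate

variable (S : Univariate)

/-- The lifted quadrature `f ↦ ∑ aᵢ f(t^i_{∞,v}; c)`, where the `j`-th coordinate of `t^i_∞` is the
`φ(j)`-th coordinate of the node `t^i ∈ D^d`. -/
def lift {d : ℕ} (φ : ℕ → Fin d) (Q : Quadrature (Fin d → S.D)) (v : Finset ℕ) : S.Algorithm :=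
  Q.map fun p => (p.1, S.restrict v fun j => p.2 (φ j))

/-- The algorithm `f ↦ Q(f - Ψ_v f)`, where `(Ψ_v f)(x) = f(x_v; c)`. -/
def difference (Q : S.Algorithm) (v : Finset ℕ) : S.Algorithm :=
  Q ++ Q.map fun p => (-p.1, S.restrict v p.2.1)

/-- The multilevel algorithm
`f ↦ f(c, c, …) + ∑_{k=1}^m Q^𝒲_{n_k, v_k} (f - Ψ_{v_{k-1}} f)`. -/
def multilevel {d : ℕ} (φ : ℕ → Fin d) (Q : ℕ → Quadrature (Fin d → S.D)) (v : ℕ → Finset ℕ)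
    (n : ℕ → ℕ) (m : ℕ) : S.Algorithm :=
  (1, S.restrict ∅ fun _ => S.c) ::
    (List.range m).flatMap fun i =>
      S.difference (S.lift φ (Q (n (i + 1))) (v (i + 1))) (v i)

end Univariate

/-- `L_0 = 0` and `L_k = L ⌈a^(k-1)⌉` for `k ≥ 1`. -/
def levelSize (L : ℕ) (a : ℝ) (k : ℕ) : ℕ := if k = 0 then 0 else L * ⌈a ^ (k - 1)⌉₊

/-- `v_k = u_1 ∪ … ∪ u_{L_k}`, in particular `v_0 = ∅`. -/
def levelSet (u : ℕ → Finset ℕ) (L : ℕ) (a : ℝ) (k : ℕ) : Finset ℕ :=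
  (Finset.Icc 1 (levelSize L a k)).biUnion u

end InfDimIntegration

end

/-! The error functional is continuous on the reproducing kernel Hilbert space, and its squared norm
is obtained by applying it to both variables of the kernel. This expression is linear in the kernel,
and the kernel is `∑ γ_u K_u`, so the squared worst case error is a series of `γ_u` times the
squared errors `componentForm u` of the algorithm on the single components (`hasSum_squaredError`,
`error_eq_sqrt`).

Since `K(c, ·) = 0`, a function in the component of `u` vanishes as soon as one coordinate in `u` is
anchored. Hence the multilevel sum telescopes on each component. If `u` first fits into `v_k`, only
level `k` sees it, and there the algorithm acts as `Q_{n_k}` on the `d`-dimensional component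
`φ(u)`, because `φ` is injective on `u`. If `u` does not fit into `v_m`, the algorithm gives `0` and
the squared error is `C₀^|u|`. A set `u_j` that does not fit into `v_k` has `j > L_k`. The squared
error is therefore at most a constant times `∑ n_k^(-2τ) T(L_{k-1}) + T(L_m)`, where `T(N)` bounds
the tail sum of `γ̂_{u_j}` over `j > N` (`IsOrdering.tsum_multilevel_le`). Any `τ < α` absorbs the
logarithms, and `T(N) ≲ (N+1)^(-r)` for any `0 < r < decay - 1`.

The sets `u_j` have at most `d` elements, so `|v_k| ≲ a^k` and the cost is of order `∑ n_k a^(sk)`.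
With `b = a^(r/2)`, the choice `n_k ≈ (b^k ε)^(-p)` and `b^m ≈ 1/ε` balances error and cost
(`exists_levels`): the error series is geometric and dominated by the last level if `pτ > 1`, and
the cost is of order `ε^(-p)` if `a^s < b^p`, that is, `2s < pr`. Suitable `τ` and `r` exist for
every `p` above the claimed maximum. -/

namespace InfDimIntegration

/-! ### Worst case errors in terms of the kernel -/

section Representer

variable {X : Type} (k : X → X → ℝ) [hk : Fact (Matrix.of k).PosSemidef]

/-- The function `k(·, y)` as an element of `H(k)`. -/
noncomputable def kernelSection (y : X) : HilbertOf k := RKHS.kerFun (HilbertOf k) y (1 : ℝ)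

theorem kernelSection_apply (x y : X) : kernelSection k y x = k x y := by
  have h : (kernelSection k y : X → ℝ) x = RKHS.kernel (HilbertOf k) x y (1 : ℝ) :=
    RKHS.kerFun_apply (HilbertOf k) y (1 : ℝ) x
  rw [h, RKHS.OfKernel.kernel_ofKernel]
  simp [opKernel]

theorem coe_kernelSection (y : X) : (kernelSection k y : X → ℝ) = fun x => k x y :=
  funext fun x => kernelSection_apply k x y

theorem kernel_symm (x y : X) : k x y = k y x := by
  simpa using hk.out.1.apply y x

theorem inner_kernelSection (f : HilbertOf k) (y : X) : inner ℝ f (kernelSection k y) = f y := by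
  simp [kernelSection]

theorem abs_apply_le (f : HilbertOf k) (x : X) : |f x| ≤ ‖f‖ * √(k x x) := by
  have h : ‖kernelSection k x‖ = √(k x x) := by
    rw [← kernelSection_apply k x x, ← inner_kernelSection, real_inner_self_eq_norm_sq,
      Real.sqrt_sq (norm_nonneg _)]
  rw [← inner_kernelSection, ← h]
  exact abs_real_inner_le_norm _ _

/-- The normalised Riesz representer attains the supremum. -/
theorem worstCaseError_eq_norm (L : HilbertOf k →L[ℝ] ℝ) (T Q : (X → ℝ) → ℝ)
    (hL : ∀ f : HilbertOf k, L f = T f - Q f) :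
    worstCaseError k T Q = ENNReal.ofReal ‖L‖ := by
  unfold worstCaseError
  simp only [← hL]
  refine le_antisymm (iSup₂_le fun f hf => ENNReal.ofReal_le_ofReal ?_) ?_
  · exact (L.le_opNorm f).trans (mul_le_of_le_one_right (norm_nonneg _) hf)
  · set h := (InnerProductSpace.toDual ℝ (HilbertOf k)).symm L with hh
    have hn : ‖h‖ = ‖L‖ := LinearIsometryEquiv.norm_map _ _
    have hLh : ∀ f, L f = inner ℝ h f := fun f => by simp [hh]
    by_cases h0 : ‖h‖ = 0
    · simp [← hn, h0]
    · refine le_iSup₂_of_le (‖h‖⁻¹ • h) ?_ ?_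
      · rw [norm_smul, norm_inv, norm_norm, inv_mul_cancel₀ h0]
      · rw [hLh, inner_smul_right, real_inner_self_eq_norm_sq, ← hn]
        refine ENNReal.ofReal_le_ofReal ?_
        rw [sq, ← mul_assoc, inv_mul_cancel₀ h0, one_mul]
        exact le_abs_self _

/-- By the reproducing property the Riesz representer `h` is explicit: `h(y) = L(k(·, y))`. Then
`‖L‖² = L h` applies the functional a second time. -/
theorem norm_sq_eq_iterate (L : HilbertOf k →L[ℝ] ℝ) (E : (X → ℝ) → ℝ)
    (hL : ∀ f : HilbertOf k, L f = E f) :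
    ‖L‖ ^ 2 = E fun y => E fun x => k x y := by
  set h := (InnerProductSpace.toDual ℝ (HilbertOf k)).symm L with hh
  have hn : ‖h‖ = ‖L‖ := LinearIsometryEquiv.norm_map _ _
  have hLh : ∀ f, L f = inner ℝ h f := fun f => by simp [hh]
  rw [← hn, ← real_inner_self_eq_norm_sq, ← hLh, hL]
  congr 1
  ext y
  rw [← inner_kernelSection, ← hLh, hL]
  congr 1
  ext x
  exact kernelSection_apply k x y

/-- Linear combinations of kernel sections are dense and measurable, and norm convergence implies
pointwise convergence because evaluations are continuous. -/
theorem measurable_coe [MeasurableSpace X] (hm : ∀ y, Measurable fun x => k x y)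
    (f : HilbertOf k) : Measurable (f : X → ℝ) := by
  have hf : f ∈ (Submodule.span ℝ {RKHS.kerFun (HilbertOf k) x v | (x) (v)}).topologicalClosure := by
    rw [RKHS.kerFun_dense]; trivial
  obtain ⟨g, hg, hlim⟩ := mem_closure_iff_seq_limit.mp hf
  refine measurable_of_tendsto_metrizable (f := fun n => (g n : X → ℝ)) (fun n => ?_) ?_
  · have hgn : g n ∈ Submodule.span ℝ {RKHS.kerFun (HilbertOf k) x v | (x) (v)} := hg n
    refine Submodule.span_induction (p := fun (h : HilbertOf k) _ => Measurable (h : X → ℝ))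
      ?_ ?_ ?_ ?_ hgn
    · rintro _ ⟨y, v, rfl⟩
      have : (RKHS.kerFun (HilbertOf k) y v : X → ℝ) = fun x => k x y * v := by
        ext x
        rw [RKHS.kerFun_apply (HilbertOf k) y v x, RKHS.OfKernel.kernel_ofKernel]
        simp [opKernel]
      rw [this]
      exact (hm y).mul_const v
    · rw [RKHS.coe_zero]; exact measurable_zero
    · intro f g _ _ hf hg
      rw [RKHS.coe_add]; exact hf.add hg
    · intro a f _ hf
      rw [RKHS.coe_smul]; exact hf.const_smul a
  · rw [tendsto_pi_nhds]
    intro x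
    exact ((RKHS.continuous_eval x).tendsto f).comp hlim

end Representer

/-! ### Linearity of quadratures -/

theorem Quadrature.eval_cons {X : Type} (p : ℝ × X) (Q : Quadrature X) (f : X → ℝ) :
    Quadrature.eval (p :: Q) f = p.1 * f p.2 + Quadrature.eval Q f := by
  simp [Quadrature.eval]

theorem Quadrature.eval_nil {X : Type} (f : X → ℝ) :
    Quadrature.eval [] f = 0 := by
  simp [Quadrature.eval]

theorem Quadrature.eval_append {X : Type} (P Q : Quadrature X) (f : X → ℝ) :
    Quadrature.eval (P ++ Q) f = P.eval f + Q.eval f := by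
  simp [Quadrature.eval]

theorem Quadrature.integral_eval {X Y : Type} [MeasurableSpace Y] (ν : Measure Y) (Q : Quadrature X)
    (F : X → Y → ℝ) (hF : ∀ x, Integrable (F x) ν) :
    Integrable (fun y => Q.eval fun x => F x y) ν ∧
      ∫ y, Q.eval (fun x => F x y) ∂ν = Q.eval fun x => ∫ y, F x y ∂ν := by
  induction Q with
  | nil => simp [Quadrature.eval]
  | cons p Q ih =>
    simp only [Quadrature.eval_cons]
    refine ⟨((hF p.2).const_mul p.1).add ih.1, ?_⟩
    rw [integral_add ((hF p.2).const_mul p.1) ih.1, integral_const_mul, ih.2]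

theorem Quadrature.eval_sub {X : Type} (Q : Quadrature X) (f g : X → ℝ) :
    (Q.eval fun x => f x - g x) = Q.eval f - Q.eval g := by
  induction Q with
  | nil => simp [Quadrature.eval]
  | cons p Q ih => simp only [Quadrature.eval_cons, ih]; ring

theorem Quadrature.hasSum_eval {X ι : Type} (Q : Quadrature X) (F : ι → X → ℝ) (G : X → ℝ)
    (h : ∀ x, HasSum (fun i => F i x) (G x)) : HasSum (fun i => Q.eval (F i)) (Q.eval G) := by
  induction Q with
  | nil => simp [Quadrature.eval]
  | cons p Q ih =>
    simp only [Quadrature.eval_cons]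
    exact ((h p.2).mul_left p.1).add ih

theorem Quadrature.eval_map {X Y : Type} (Q : Quadrature X) (g : X → Y) (f : Y → ℝ) :
    Quadrature.eval (Q.map fun p => (p.1, g p.2)) f = Q.eval fun x => f (g x) := by
  simp [Quadrature.eval, Function.comp_def]

theorem Quadrature.eval_const_mul {X : Type} (Q : Quadrature X) (a : ℝ) (f : X → ℝ) :
    (Q.eval fun x => a * f x) = a * Q.eval f := by
  induction Q with
  | nil => simp [Quadrature.eval]
  | cons p Q ih => simp only [Quadrature.eval_cons, ih]; ring

/-! ### The squared worst case error of a quadrature -/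

section Formula

variable {X : Type} [MeasurableSpace X] (μ : Measure X) (k : X → X → ℝ)

theorem integrable_coe [hk : Fact (Matrix.of k).PosSemidef] [IsFiniteMeasure μ]
    (hm : ∀ y, Measurable fun x => k x y) (hi : Integrable (fun x => k x x) μ)
    (f : HilbertOf k) : Integrable (f : X → ℝ) μ := by
  have hd : ∀ x, 0 ≤ k x x := fun x => hk.out.diag_nonneg (i := x)
  refine Integrable.mono' (((integrable_const (1:ℝ)).add hi).const_mul ‖f‖)
    (measurable_coe k hm f).aestronglyMeasurable (.of_forall fun x => ?_)
  refine (abs_apply_le k f x).trans (mul_le_mul_of_nonneg_left ?_ (norm_nonneg _))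
  have := Real.sq_sqrt (hd x)
  simp only [Pi.add_apply]
  -- The elementary bound `√t ≤ 1 + t` makes integrability of the diagonal sufficient.
  nlinarith [sq_nonneg (√(k x x) - 1), Real.sqrt_nonneg (k x x)]

/-- The error functional `f ↦ ∫ f dμ - Q(f)` as a continuous functional on `H(k)`. -/
theorem exists_errorFunctional [hk : Fact (Matrix.of k).PosSemidef] [IsFiniteMeasure μ]
    (hm : ∀ y, Measurable fun x => k x y) (hi : Integrable (fun x => k x x) μ)
    (Q : Quadrature X) :
    ∃ L : HilbertOf k →L[ℝ] ℝ, ∀ f : HilbertOf k, L f = ∫ x, f x ∂μ - Q.eval f := by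
  have hd : ∀ x, 0 ≤ k x x := fun x => hk.out.diag_nonneg (i := x)
  have hint := integrable_coe μ k hm hi
  let T : HilbertOf k →ₗ[ℝ] ℝ :=
    { toFun := fun f => ∫ x, f x ∂μ
      map_add' := fun f g => by
        rw [← integral_add (hint f) (hint g)]
        simp
      map_smul' := fun a f => by
        rw [RingHom.id_apply, smul_eq_mul, ← integral_const_mul]
        simp }
  have hT : ∀ f, ‖T f‖ ≤ (∫ x, (1 + k x x) ∂μ) * ‖f‖ := fun f => by
    rw [mul_comm, ← integral_const_mul]
    refine norm_integral_le_of_norm_le (((integrable_const (1:ℝ)).add hi).const_mul ‖f‖)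
      (.of_forall fun x => ?_)
    refine (abs_apply_le k f x).trans (mul_le_mul_of_nonneg_left ?_ (norm_nonneg _))
    have := Real.sq_sqrt (hd x)
    nlinarith [sq_nonneg (√(k x x) - 1), Real.sqrt_nonneg (k x x)]
  have hQ : ∃ L : HilbertOf k →L[ℝ] ℝ, ∀ f : HilbertOf k, L f = Q.eval f := by
    induction Q with
    | nil => exact ⟨0, fun f => by simp [Quadrature.eval]⟩
    | cons p Q ih =>
      obtain ⟨L, hL⟩ := ih
      -- Evaluation at a node is the inner product with the kernel section there.
      refine ⟨p.1 • innerSL ℝ (kernelSection k p.2) + L, fun f => ?_⟩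
      rw [Quadrature.eval_cons, ← hL, ← inner_kernelSection, real_inner_comm]
      simp
  obtain ⟨L, hL⟩ := hQ
  refine ⟨T.mkContinuous _ hT - L, fun f => ?_⟩
  simp [hL, T]

/-- The mean embedding is the Riesz representer of integration, hence itself an element of `H(k)`,
and all these are integrable. The empty quadrature turns the error functional into integration. -/
theorem integrable_integral_kernel [hk : Fact (Matrix.of k).PosSemidef] [IsFiniteMeasure μ]
    (hm : ∀ y, Measurable fun x => k x y) (hi : Integrable (fun x => k x x) μ) :
    Integrable (fun y => ∫ x, k x y ∂μ) μ := by
  obtain ⟨L, hL⟩ := exists_errorFunctional μ k hm hi []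
  set h := (InnerProductSpace.toDual ℝ (HilbertOf k)).symm L with hh
  have : (fun y => ∫ x, k x y ∂μ) = (h : X → ℝ) := by
    ext y
    have h1 := hL (kernelSection k y)
    simp only [kernelSection_apply, Quadrature.eval_nil, sub_zero] at h1
    rw [← h1, ← inner_kernelSection, hh, InnerProductSpace.toDual_symm_apply]
  rw [this]
  exact integrable_coe μ k hm hi h

/-- The squared worst case error of a quadrature for integration with respect to `μ`. -/
noncomputable def squaredError (Q : Quadrature X) : ℝ :=
  ∫ y, ∫ x, k x y ∂μ ∂μ - 2 * (Q.eval fun y => ∫ x, k x y ∂μ) + Q.eval fun y => Q.eval fun x => k x y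

/-- The squared worst case error is obtained by applying the error functional to both variables
of the kernel. -/
theorem worstCaseError_eq_sqrt [hk : Fact (Matrix.of k).PosSemidef] [IsFiniteMeasure μ]
    (hm : ∀ y, Measurable fun x => k x y) (hi : Integrable (fun x => k x x) μ)
    (Q : Quadrature X) :
    0 ≤ squaredError μ k Q ∧
    worstCaseError k (fun f => ∫ x, f x ∂μ) Q.eval = ENNReal.ofReal √(squaredError μ k Q) := by
  obtain ⟨L, hL⟩ := exists_errorFunctional μ k hm hi Q
  rw [worstCaseError_eq_norm k L _ _ hL]
  have h1 := norm_sq_eq_iterate k L (fun f => ∫ x, f x ∂μ - Q.eval f) hL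
  have hint : ∀ x, Integrable (fun y => k x y) μ := fun x => by
    have := integrable_coe μ k hm hi (kernelSection k x)
    rw [coe_kernelSection] at this
    exact this.congr (.of_forall fun y => kernel_symm k y x)
  have h2 : squaredError μ k Q = ‖L‖ ^ 2 := by
    have h3 := Q.integral_eval μ (fun x y => k x y) hint
    simp only at h1
    rw [h1, integral_sub (integrable_integral_kernel μ k hm hi) h3.1, h3.2, Quadrature.eval_sub,
      squaredError]
    have h4 : (Q.eval fun x => ∫ y, k x y ∂μ) = Q.eval fun y => ∫ x, k x y ∂μ := by
      congr 1
      ext x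
      exact integral_congr_ae (.of_forall fun y => kernel_symm k x y)
    rw [h4]
    ring
  rw [h2]
  exact ⟨sq_nonneg _, by rw [Real.sqrt_sq (norm_nonneg L)]⟩

end Formula

/-! ### Integrals over product spaces -/

section Product

variable {ι E : Type} [MeasurableSpace E] (ν : Measure E) [IsProbabilityMeasure ν]

/-- The integrand depends only on the coordinates in `u`, so Fubini on a finite product suffices. -/
theorem integral_prod_infinitePi (u : Finset ι) {g : ι → E → ℝ} (hg : ∀ j, Measurable (g j)) :
    ∫ x, ∏ j ∈ u, g j (x j) ∂(Measure.infinitePi fun _ : ι => ν) = ∏ j ∈ u, ∫ y, g j y ∂ν := by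
  have h := integral_restrict_infinitePi (μ := fun _ : ι => ν) (s := u)
    (f := fun x : u → E => ∏ j : u, g j (x j)) (by
      refine Measurable.aestronglyMeasurable ?_
      exact Finset.measurable_fun_prod _ fun j _ => (hg j).comp (measurable_pi_apply j))
  rw [integral_fintype_prod_eq_prod, Finset.prod_coe_sort u fun j => ∫ y, g j y ∂ν] at h
  rw [← h]
  refine integral_congr_ae (.of_forall fun x => ?_)
  exact (Finset.prod_coe_sort u fun j => g j (x j)).symm

theorem integrable_prod_infinitePi (u : Finset ι) {g : ι → E → ℝ}
    (hi : ∀ j, Integrable (g j) ν) :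
    Integrable (fun x => ∏ j ∈ u, g j (x j)) (Measure.infinitePi fun _ : ι => ν) := by
  have h : Integrable (fun x : u → E => ∏ j : u, g j (x j)) (Measure.pi fun _ : u => ν) :=
    Integrable.fintype_prod (f := fun j : u => g j) fun j => hi j
  rw [← Measure.infinitePi_map_restrict (μ := fun _ : ι => ν)] at h
  have h2 := h.comp_measurable (Finset.measurable_restrict u)
  refine h2.congr (.of_forall fun x => ?_)
  exact Finset.prod_coe_sort u fun j => g j (x j)

end Product

/-! ### Mean embeddings and errors of the components `K_u` -/

namespace Univariate

variable (S : Univariate)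

instance : Fact (Matrix.of S.K).PosSemidef := ⟨S.posSemidef_K⟩

/-- The mean embedding `∫ K(·, y) dρ`. -/
noncomputable def mean (y : S.D) : ℝ := ∫ x, S.K x y ∂S.ρ

theorem measurable_mean : Measurable S.mean := by
  have : StronglyMeasurable (fun p : S.D × S.D => S.K p.2 p.1) :=
    (S.measurable_K.comp measurable_swap).stronglyMeasurable
  exact (this.integral_prod_right (ν := S.ρ)).measurable

theorem measurable_K_left (y : S.D) : Measurable fun x => S.K x y :=
  S.measurable_K.comp (measurable_id.prodMk measurable_const)

theorem measurable_K_diag : Measurable fun x => S.K x x :=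
  S.measurable_K.comp (measurable_id.prodMk measurable_id)

theorem K_self_nonneg (x : S.D) : 0 ≤ S.K x x := S.posSemidef_K.diag_nonneg (i := x)

theorem integrable_K_left (y : S.D) : Integrable (fun x => S.K x y) S.ρ := by
  rw [← coe_kernelSection S.K y]
  exact integrable_coe S.ρ S.K S.measurable_K_left S.integrable_diag (kernelSection S.K y)

theorem integrable_mean : Integrable S.mean S.ρ :=
  integrable_integral_kernel S.ρ S.K S.measurable_K_left S.integrable_diag

theorem integral_mean : ∫ y, S.mean y ∂S.ρ = S.C₀ := by
  unfold mean C₀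
  refine integral_congr_ae (.of_forall fun x => integral_congr_ae (.of_forall fun y => ?_))
  exact kernel_symm S.K y x

/-- Every `f` in `H(K)` satisfies `|f(c)| ≤ ‖f‖ √K(c,c) = 0`; this is applied to the kernel
sections. -/
theorem K_anchor_right (x : S.D) : S.K x S.c = 0 := by
  have h := abs_apply_le S.K (kernelSection S.K x) S.c
  rw [S.K_anchor, Real.sqrt_zero, mul_zero, kernelSection_apply] at h
  rw [kernel_symm S.K]
  exact abs_nonpos_iff.mp h

theorem mean_anchor : S.mean S.c = 0 := by
  simp [mean, K_anchor_right]

section ProdKernel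

variable {ι : Type} (u : Finset ι)

theorem prodKernel_self_nonneg (x : ι → S.D) : 0 ≤ S.prodKernel u x x :=
  Finset.prod_nonneg fun j _ => S.K_self_nonneg (x j)

theorem abs_prodKernel_le (x y : ι → S.D) :
    |S.prodKernel u x y| ≤ S.prodKernel u x x + S.prodKernel u y y :=
  Weights.abs_le_of_posSemidef (S.prodKernel_posSemidef u) x y

theorem measurable_prodKernel_left (y : ι → S.D) : Measurable fun x => S.prodKernel u x y :=
  Finset.measurable_fun_prod _ fun j _ => (S.measurable_K_left (y j)).comp (measurable_pi_apply j)

theorem measurable_prodKernel_self : Measurable fun x : ι → S.D => S.prodKernel u x x :=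
  Finset.measurable_fun_prod _ fun j _ => S.measurable_K_diag.comp (measurable_pi_apply j)

theorem integrable_prodKernel_self :
    Integrable (fun x : ι → S.D => S.prodKernel u x x) (Measure.infinitePi fun _ : ι => S.ρ) :=
  integrable_prod_infinitePi S.ρ u (g := fun _ x => S.K x x) fun _ => S.integrable_diag

theorem integral_prodKernel_self :
    ∫ x, S.prodKernel u x x ∂(Measure.infinitePi fun _ : ι => S.ρ) = S.M ^ u.card := by
  refine (integral_prod_infinitePi S.ρ u (g := fun _ x => S.K x x)
    fun _ => S.measurable_K_diag).trans ?_
  simp [M]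

theorem integrable_prodKernel_left (y : ι → S.D) :
    Integrable (fun x : ι → S.D => S.prodKernel u x y) (Measure.infinitePi fun _ : ι => S.ρ) :=
  integrable_prod_infinitePi S.ρ u (g := fun j x => S.K x (y j)) fun j => S.integrable_K_left (y j)

theorem integral_prodKernel_left (y : ι → S.D) :
    ∫ x, S.prodKernel u x y ∂(Measure.infinitePi fun _ : ι => S.ρ) = ∏ j ∈ u, S.mean (y j) :=
  integral_prod_infinitePi S.ρ u (g := fun j x => S.K x (y j)) fun j => S.measurable_K_left (y j)

theorem integrable_prod_mean :
    Integrable (fun y : ι → S.D => ∏ j ∈ u, S.mean (y j)) (Measure.infinitePi fun _ : ι => S.ρ) :=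
  integrable_prod_infinitePi S.ρ u (g := fun _ x => S.mean x) fun _ => S.integrable_mean

theorem integral_prod_mean :
    ∫ y : ι → S.D, ∏ j ∈ u, S.mean (y j) ∂(Measure.infinitePi fun _ : ι => S.ρ) =
      S.C₀ ^ u.card := by
  refine (integral_prod_infinitePi S.ρ u (g := fun _ x => S.mean x)
    fun _ => S.measurable_mean).trans ?_
  simp [integral_mean]

/-- Obtained by integrating the bound for `|K_u(x, y)|` over `x`. It supplies the majorant for
termwise integration of the mean embedding. -/
theorem abs_prod_mean_le (y : ι → S.D) :
    |∏ j ∈ u, S.mean (y j)| ≤ S.M ^ u.card + S.prodKernel u y y := by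
  rw [← integral_prodKernel_left, ← integral_prodKernel_self]
  have h : Integrable (fun x : ι → S.D => S.prodKernel u x x + S.prodKernel u y y)
      (Measure.infinitePi fun _ : ι => S.ρ) :=
    (S.integrable_prodKernel_self u).add (integrable_const _)
  refine (norm_integral_le_of_norm_le (f := fun x => S.prodKernel u x y) h (.of_forall fun x => S.abs_prodKernel_le u x y)).trans
    (le_of_eq ?_)
  rw [integral_add (S.integrable_prodKernel_self u) (integrable_const _)]
  simp

/-- The squared worst case error over `H_u` of a quadrature for integration with respect to the
product of copies of `ρ`. -/
noncomputable def componentForm (Q : Quadrature (ι → S.D)) : ℝ :=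
  S.C₀ ^ u.card - 2 * (Q.eval fun y => ∏ j ∈ u, S.mean (y j)) +
    Q.eval fun y => Q.eval fun x => S.prodKernel u x y

theorem squaredError_prodKernel (Q : Quadrature (ι → S.D)) :
    squaredError (Measure.infinitePi fun _ : ι => S.ρ) (S.prodKernel u) Q =
      S.componentForm u Q := by
  simp only [squaredError, componentForm, integral_prodKernel_left, integral_prod_mean]

end ProdKernel

theorem componentError_eq {d : ℕ} (Q : Quadrature (Fin d → S.D)) (e : Finset (Fin d)) :
    0 ≤ S.componentForm e Q ∧
      S.componentError Q e = ENNReal.ofReal √(S.componentForm e Q) := by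
  have h := worstCaseError_eq_sqrt (Measure.infinitePi fun _ : Fin d => S.ρ) (S.prodKernel e)
    (S.measurable_prodKernel_left e) (S.integrable_prodKernel_self e) Q
  rw [squaredError_prodKernel] at h
  refine ⟨h.1, ?_⟩
  rw [← h.2, componentError, Measure.infinitePi_eq_pi]

end Univariate

namespace Weights

variable {S : Univariate} (W : Weights S)

/-! ### The domain of the functions of infinitely many variables -/

theorem weighted_prodKernel_self_nonneg (u : Finset ℕ) (x : ℕ → S.D) :
    0 ≤ W.γ u * S.prodKernel u x x :=
  mul_nonneg (W.nonneg u) (S.prodKernel_self_nonneg u x)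

theorem mem_domain_iff (x : ℕ → S.D) :
    x ∈ W.domain ↔ ∑' u, ENNReal.ofReal (W.γ u * S.prodKernel u x x) < ⊤ := by
  refine ⟨fun h => Summable.tsum_ofReal_lt_top h, fun h => ?_⟩
  refine (ENNReal.summable_toReal h.ne).congr fun u => ?_
  exact ENNReal.toReal_ofReal (W.weighted_prodKernel_self_nonneg u x)

theorem measurable_ofReal_weighted (u : Finset ℕ) :
    Measurable fun x => ENNReal.ofReal (W.γ u * S.prodKernel u x x) :=
  ((S.measurable_prodKernel_self u).const_mul _).ennreal_ofReal

theorem measurableSet_domain : MeasurableSet W.domain := by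
  have : W.domain = {x | ∑' u, ENNReal.ofReal (W.γ u * S.prodKernel u x x) < ⊤} :=
    Set.ext W.mem_domain_iff
  rw [this]
  exact measurableSet_lt (Measurable.tsum W.measurable_ofReal_weighted) measurable_const

/-- By Tonelli, the series that defines the domain has the finite expectation `∑ γ_u M^|u|`. -/
theorem ae_mem_domain : ∀ᵐ x ∂(Measure.infinitePi fun _ : ℕ => S.ρ), x ∈ W.domain := by
  simp only [mem_domain_iff]
  refine ae_lt_top (Measurable.tsum W.measurable_ofReal_weighted) ?_
  rw [lintegral_tsum fun u => (W.measurable_ofReal_weighted u).aemeasurable]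
  refine ne_of_eq_of_ne (tsum_congr fun u => ?_) W.summable.tsum_ofReal_ne_top
  rw [← ofReal_integral_eq_lintegral_ofReal ((S.integrable_prodKernel_self u).const_mul _)
    (.of_forall (W.weighted_prodKernel_self_nonneg u)), integral_const_mul,
    S.integral_prodKernel_self]

/-- The product measure on the domain. -/
noncomputable def domainMeasure : Measure W.domain :=
  (Measure.infinitePi fun _ : ℕ => S.ρ).comap (Subtype.val : W.domain → ℕ → S.D)

theorem map_domainMeasure :
    W.domainMeasure.map Subtype.val = Measure.infinitePi fun _ : ℕ => S.ρ := by
  rw [domainMeasure, map_comap_subtype_coe W.measurableSet_domain,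
    Measure.restrict_eq_self_of_ae_mem W.ae_mem_domain]

instance : IsProbabilityMeasure W.domainMeasure := by
  refine ⟨?_⟩
  have h := congrArg (fun μ => μ Set.univ) W.map_domainMeasure
  simpa [Measure.map_apply measurable_subtype_coe MeasurableSet.univ] using h

theorem integral_domainMeasure (f : (ℕ → S.D) → ℝ) :
    ∫ x, f x.1 ∂W.domainMeasure = ∫ x, f x ∂(Measure.infinitePi fun _ : ℕ => S.ρ) := by
  rw [← W.map_domainMeasure]
  exact ((MeasurableEmbedding.subtype_coe W.measurableSet_domain).integral_map f).symm

theorem integrable_domainMeasure {f : (ℕ → S.D) → ℝ}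
    (hf : Integrable f (Measure.infinitePi fun _ : ℕ => S.ρ)) :
    Integrable (fun x => f x.1) W.domainMeasure := by
  rw [← W.map_domainMeasure] at hf
  exact hf.comp_measurable measurable_subtype_coe

/-! ### The worst case error as a series over the components -/

theorem measurable_kernel_left (y : W.domain) : Measurable fun x => W.kernel x y := by
  exact Measurable.tsum fun u =>
    ((S.measurable_prodKernel_left u y.1).comp measurable_subtype_coe).const_mul (W.γ u)

/-- Termwise integration of a series whose terms are bounded by
`γ_u (M^|u| + K_u(x, x) + b_u)`. -/
theorem hasSum_integral_domain (F : Finset ℕ → (ℕ → S.D) → ℝ) (b : Finset ℕ → ℝ)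
    (hb : Summable fun u => W.γ u * b u)
    (hF : ∀ u, Integrable (F u) (Measure.infinitePi fun _ : ℕ => S.ρ))
    (hle : ∀ u x, |F u x| ≤ S.prodKernel u x x + b u) :
    HasSum (fun u => W.γ u * ∫ x, F u x ∂(Measure.infinitePi fun _ : ℕ => S.ρ))
      (∫ x : W.domain, ∑' u, W.γ u * F u x.1 ∂W.domainMeasure) := by
  have h := hasSum_integral_of_summable_integral_norm (μ := W.domainMeasure)
    (F := fun u (x : W.domain) => W.γ u * F u x.1)
    (fun u => (W.integrable_domainMeasure (hF u)).const_mul _) ?_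
  · have he : (fun u => W.γ u * ∫ x, F u x ∂(Measure.infinitePi fun _ : ℕ => S.ρ)) =
        fun u => ∫ x : W.domain, W.γ u * F u x.1 ∂W.domainMeasure := by
      ext u
      rw [integral_const_mul, W.integral_domainMeasure (F u)]
    rw [he]
    exact h
  · refine Summable.of_nonneg_of_le (fun u => integral_nonneg fun x => norm_nonneg _)
      (fun u => ?_) (W.summable.add hb)
    have hi : Integrable (fun x : W.domain => S.prodKernel u x.1 x.1) W.domainMeasure :=
      W.integrable_domainMeasure (S.integrable_prodKernel_self u)
    calc ∫ x : W.domain, ‖W.γ u * F u x.1‖ ∂W.domainMeasure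
        ≤ ∫ x : W.domain, W.γ u * (S.prodKernel u x.1 x.1 + b u) ∂W.domainMeasure := by
          refine integral_mono ((W.integrable_domainMeasure (hF u)).const_mul _).norm
            ((hi.add (integrable_const _)).const_mul _) fun x => ?_
          simp only [norm_mul, Real.norm_eq_abs, abs_of_nonneg (W.nonneg u)]
          exact mul_le_mul_of_nonneg_left (hle u x.1) (W.nonneg u)
      _ = W.γ u * S.M ^ u.card + W.γ u * b u := by
          rw [integral_const_mul, integral_add hi (integrable_const _),
            W.integral_domainMeasure fun x => S.prodKernel u x x, S.integral_prodKernel_self]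
          simp [mul_add]

/-- Each of the three terms of `squaredError` is linear in the kernel and is expanded termwise. For
the mean embedding at `y` the majorant uses `b_u = K_u(y, y)`, summable against `γ` because `y` lies
in the domain; for the double integral it uses `b_u = M^|u|`. -/
theorem hasSum_squaredError (Q : S.Algorithm) :
    HasSum (fun u => W.γ u * S.componentForm u (Q.map fun p => (p.1, p.2.1)))
      (squaredError W.domainMeasure W.kernel (Q.map fun p => (p.1, W.point p.2))) := by
  have hker : ∀ x y : W.domain,
      HasSum (fun u => W.γ u * S.prodKernel u x.1 y.1) (W.kernel x y) :=
    fun x y => (W.summable_kernel x y).hasSum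
  have hmean : ∀ y : W.domain, HasSum (fun u => W.γ u * ∏ j ∈ u, S.mean (y.1 j))
      (∫ x, W.kernel x y ∂W.domainMeasure) := fun y => by
    have := W.hasSum_integral_domain (fun u x => S.prodKernel u x y.1)
      (fun u => S.prodKernel u y.1 y.1) y.2 (fun u => S.integrable_prodKernel_left u y.1)
      fun u x => S.abs_prodKernel_le u x y.1
    simp only [S.integral_prodKernel_left] at this
    exact this
  have hC : HasSum (fun u => W.γ u * S.C₀ ^ u.card)
      (∫ y, ∫ x, W.kernel x y ∂W.domainMeasure ∂W.domainMeasure) := by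
    have := W.hasSum_integral_domain (fun u y => ∏ j ∈ u, S.mean (y j))
      (fun u => S.M ^ u.card) W.summable (fun u => S.integrable_prod_mean u)
      fun u x => (S.abs_prod_mean_le u x).trans_eq (add_comm _ _)
    simp only [S.integral_prod_mean, fun y => (hmean y).tsum_eq] at this
    exact this
  set Q' : Quadrature W.domain := Q.map fun p => (p.1, W.point p.2) with hQ'
  have h := (hC.sub ((Q'.hasSum_eval _ _ hmean).mul_left 2)).add
    (Q'.hasSum_eval _ _ fun y => Q'.hasSum_eval _ _ fun x => hker x y)
  have heval : ∀ f : (ℕ → S.D) → ℝ,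
      (Q'.eval fun x => f x.1) = Quadrature.eval (Q.map fun p => (p.1, p.2.1)) f := fun f =>
    (Quadrature.eval_map Q W.point _).trans
      (Quadrature.eval_map Q (fun x : S.AdmissiblePoint => x.1) f).symm
  refine Eq.mp (congrArg (fun F => HasSum F _) (funext fun u => ?_)) h
  simp only [Quadrature.eval_const_mul, Univariate.componentForm, ← heval]
  ring

/-- The worst case error over the space of functions of infinitely many variables. -/
theorem error_eq_sqrt (Q : S.Algorithm) :
    W.error Q = ENNReal.ofReal
      √(∑' u, W.γ u * S.componentForm u (Q.map fun p => (p.1, p.2.1))) := by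
  have hi : Integrable (fun x => W.kernel x x) W.domainMeasure := by
    refine ⟨(Measurable.tsum fun u => ((S.measurable_prodKernel_self u).comp
      measurable_subtype_coe).const_mul (W.γ u)).aestronglyMeasurable, ?_⟩
    have hnn : ∀ x : W.domain, 0 ≤ W.kernel x x := fun x =>
      tsum_nonneg fun u => W.weighted_prodKernel_self_nonneg u x.1
    have hm : ∀ u, Measurable fun x : W.domain =>
        ENNReal.ofReal (W.γ u * S.prodKernel u x.1 x.1) := fun u =>
      (W.measurable_ofReal_weighted u).comp measurable_subtype_coe
    rw [hasFiniteIntegral_iff_ofReal (.of_forall hnn)]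
    have he : ∀ x : W.domain, ENNReal.ofReal (W.kernel x x) =
        ∑' u, ENNReal.ofReal (W.γ u * S.prodKernel u x.1 x.1) := fun x =>
      ENNReal.ofReal_tsum_of_nonneg (fun u => W.weighted_prodKernel_self_nonneg u x.1) x.2
    simp only [he]
    rw [lintegral_tsum fun u => (hm u).aemeasurable]
    refine lt_of_eq_of_lt (tsum_congr fun u => ?_) W.summable.tsum_ofReal_lt_top
    rw [← ofReal_integral_eq_lintegral_ofReal
      ((W.integrable_domainMeasure (S.integrable_prodKernel_self u)).const_mul _)
      (.of_forall fun x => W.weighted_prodKernel_self_nonneg u x.1), integral_const_mul,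
      W.integral_domainMeasure fun x => S.prodKernel u x x, S.integral_prodKernel_self]
  rw [(W.hasSum_squaredError Q).tsum_eq, ← (worstCaseError_eq_sqrt W.domainMeasure W.kernel
    W.measurable_kernel_left hi _).2, error]
  congr 1
  ext f
  exact (Quadrature.eval_map Q W.point f).symm

end Weights

namespace Univariate

variable (S : Univariate)

/-! ### The multilevel algorithm on the components -/

theorem eval_coe (Q : S.Algorithm) (F : (ℕ → S.D) → ℝ) :
    Quadrature.eval (Q.map fun p => (p.1, p.2.1)) F = Q.eval fun x => F x.1 :=
  Quadrature.eval_map Q (fun x : S.AdmissiblePoint => x.1) F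

theorem eval_difference (Q : S.Algorithm) (v : Finset ℕ) (F : S.AdmissiblePoint → ℝ) :
    (S.difference Q v).eval F = Q.eval fun x => F x - F (S.restrict v x.1) := by
  have h : Quadrature.eval (Q.map fun p => (-p.1, S.restrict v p.2.1)) F =
      -Q.eval fun x => F (S.restrict v x.1) := by
    induction Q with
    | nil => simp [Quadrature.eval]
    | cons p Q ih =>
      rw [List.map_cons, Quadrature.eval_cons, Quadrature.eval_cons, ih]
      ring
  rw [difference, Quadrature.eval_append, h, Quadrature.eval_sub, sub_eq_add_neg]

variable {d : ℕ} (φ : ℕ → Fin d)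

theorem eval_lift (q : Quadrature (Fin d → S.D)) (v : Finset ℕ) (F : S.AdmissiblePoint → ℝ) :
    (S.lift φ q v).eval F = q.eval fun t => F (S.restrict v fun j => t (φ j)) :=
  Quadrature.eval_map q (fun t => S.restrict v fun j => t (φ j)) F

theorem eval_multilevel (Q : ℕ → Quadrature (Fin d → S.D)) (v : ℕ → Finset ℕ) (n : ℕ → ℕ) (m : ℕ)
    (F : S.AdmissiblePoint → ℝ) :
    (S.multilevel φ Q v n m).eval F = F (S.restrict ∅ fun _ => S.c) +
      ∑ i ∈ Finset.range m, (Q (n (i + 1))).eval fun t =>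
        F (S.restrict (v (i + 1)) fun j => t (φ j)) -
          F (S.restrict (v i) (S.restrict (v (i + 1)) fun j => t (φ j)).1) := by
  rw [multilevel, Quadrature.eval_cons, one_mul]
  congr 1
  induction m with
  | zero => simp [Quadrature.eval]
  | succ m ih =>
    rw [List.range_succ, List.flatMap_append, Quadrature.eval_append, ih, Finset.sum_range_succ]
    congr 1
    rw [List.flatMap_singleton, eval_difference, eval_lift]

theorem restrict_apply_of_mem {v : Finset ℕ} {j : ℕ} (hj : j ∈ v) (x : ℕ → S.D) :
    (S.restrict v x).1 j = x j := if_pos hj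

theorem restrict_apply_of_notMem {v : Finset ℕ} {j : ℕ} (hj : j ∉ v) (x : ℕ → S.D) :
    (S.restrict v x).1 j = S.c := if_neg hj

/-- `F` depends only on the coordinates in `u` and vanishes if one of these is the anchor. -/
structure IsAnchored (u : Finset ℕ) (F : (ℕ → S.D) → ℝ) : Prop where
  congr : ∀ x y, (∀ j ∈ u, x j = y j) → F x = F y
  eq_zero : ∀ x, (∃ j ∈ u, x j = S.c) → F x = 0

variable {S}

theorem IsAnchored.restrict_eq {u v : Finset ℕ} {F : (ℕ → S.D) → ℝ} (hF : S.IsAnchored u F)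
    (h : u ⊆ v) (x : ℕ → S.D) : F (S.restrict v x).1 = F x :=
  hF.congr _ _ fun _ hj => S.restrict_apply_of_mem (h hj) x

theorem IsAnchored.restrict_eq_zero {u v : Finset ℕ} {F : (ℕ → S.D) → ℝ} (hF : S.IsAnchored u F)
    (h : ¬u ⊆ v) (x : ℕ → S.D) : F (S.restrict v x).1 = 0 := by
  obtain ⟨j, hj, hjv⟩ := Finset.not_subset.mp h
  exact hF.eq_zero _ ⟨j, hj, S.restrict_apply_of_notMem hjv x⟩

theorem eval_zero {X : Type} (Q : Quadrature X) : (Q.eval fun _ => 0) = 0 := by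
  simp [Quadrature.eval]

theorem IsAnchored.eval_multilevel_of_not_subset {u : Finset ℕ} {F : (ℕ → S.D) → ℝ}
    (hF : S.IsAnchored u F) (Q : ℕ → Quadrature (Fin d → S.D)) {v : ℕ → Finset ℕ}
    (hv : Monotone v) (n : ℕ → ℕ) {m : ℕ} (hm : ¬u ⊆ v m) :
    ((S.multilevel φ Q v n m).eval fun x => F x.1) = 0 := by
  have h : ∀ i ≤ m, ¬u ⊆ v i := fun i hi hu => hm (hu.trans (hv hi))
  have h0 : ¬u ⊆ ∅ := fun hu => hm (hu.trans (Finset.empty_subset _))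
  rw [eval_multilevel, hF.restrict_eq_zero h0, zero_add]
  refine Finset.sum_eq_zero fun i hi => ?_
  have hi := Finset.mem_range.mp hi
  simp only [hF.restrict_eq_zero (h i hi.le), hF.restrict_eq_zero (h (i + 1) hi), sub_zero,
    eval_zero]

/-- Telescoping: on earlier levels both terms of the difference vanish, on later levels they cancel,
and on the level where `u` first fits only the subtracted term vanishes. -/
theorem IsAnchored.eval_multilevel_of_subset {u : Finset ℕ} {F : (ℕ → S.D) → ℝ}
    (hF : S.IsAnchored u F) (Q : ℕ → Quadrature (Fin d → S.D)) {v : ℕ → Finset ℕ}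
    (hv : Monotone v) (n : ℕ → ℕ) {k m : ℕ} (hk : k < m) (h1 : ¬u ⊆ v k) (h2 : u ⊆ v (k + 1)) :
    ((S.multilevel φ Q v n m).eval fun x => F x.1) =
      (Q (n (k + 1))).eval fun t => F fun j => t (φ j) := by
  have h0 : ¬u ⊆ ∅ := fun hu => h1 (hu.trans (Finset.empty_subset _))
  rw [eval_multilevel, hF.restrict_eq_zero h0, zero_add,
    Finset.sum_eq_single_of_mem k (Finset.mem_range.mpr hk)]
  · simp only [hF.restrict_eq_zero h1, hF.restrict_eq h2, sub_zero]
  · intro i _ hik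
    rcases lt_or_gt_of_ne hik with hlt | hgt
    · have hi1 : ¬u ⊆ v (i + 1) := fun h => h1 (h.trans (hv (by omega)))
      have hi : ¬u ⊆ v i := fun h => h1 (h.trans (hv (by omega)))
      simp only [hF.restrict_eq_zero hi, hF.restrict_eq_zero hi1, sub_zero, eval_zero]
    · have hi : u ⊆ v i := h2.trans (hv (by omega))
      have hi1 : u ⊆ v (i + 1) := h2.trans (hv (by omega))
      simp only [hF.restrict_eq hi, hF.restrict_eq hi1, sub_self, eval_zero]

theorem isAnchored_prod {u : Finset ℕ} (g : ℕ → S.D → ℝ) (hg : ∀ j ∈ u, g j S.c = 0) :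
    S.IsAnchored u fun x => ∏ j ∈ u, g j (x j) where
  congr x y h := Finset.prod_congr rfl fun j hj => by rw [h j hj]
  eq_zero := by
    rintro x ⟨j, hj, hx⟩
    exact Finset.prod_eq_zero hj (by rw [hx, hg j hj])

theorem isAnchored_prod_mean (u : Finset ℕ) :
    S.IsAnchored u fun x => ∏ j ∈ u, S.mean (x j) :=
  isAnchored_prod (fun _ => S.mean) fun _ _ => S.mean_anchor

theorem isAnchored_prodKernel_left (u : Finset ℕ) (y : ℕ → S.D) :
    S.IsAnchored u fun x => S.prodKernel u x y :=
  isAnchored_prod (fun j x => S.K x (y j)) fun j _ => by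
    rw [kernel_symm S.K, S.K_anchor_right]

theorem isAnchored_prodKernel_right (u : Finset ℕ) (x : ℕ → S.D) :
    S.IsAnchored u fun y => S.prodKernel u x y :=
  isAnchored_prod (fun j y => S.K (x j) y) fun j _ => S.K_anchor_right (x j)

/-- After the quadrature has acted on one variable of `K_u`, the result is still anchored in the
other, so the telescoping applies a second time. -/
theorem IsAnchored.eval {X : Type} (q : Quadrature X) {u : Finset ℕ} {F : X → (ℕ → S.D) → ℝ}
    (hF : ∀ t, S.IsAnchored u (F t)) : S.IsAnchored u fun y => q.eval fun t => F t y where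
  congr x y h := by
    congr 1
    ext t
    exact (hF t).congr x y h
  eq_zero x h := by simp only [fun t => (hF t).eq_zero x h, eval_zero]

/-- On constants all level differences cancel and the evaluation at the anchor is exact, which
leaves `1 - 2 + 1`. -/
theorem componentForm_multilevel_empty (Q : ℕ → Quadrature (Fin d → S.D)) (v : ℕ → Finset ℕ)
    (n : ℕ → ℕ) (m : ℕ) :
    S.componentForm ∅ ((S.multilevel φ Q v n m).map fun p => (p.1, p.2.1)) = 0 := by
  simp only [componentForm, eval_coe, prodKernel, Finset.prod_empty, eval_multilevel, sub_self,
    eval_zero, Finset.sum_const_zero, Finset.card_empty]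
  norm_num

theorem componentForm_multilevel_of_not_subset {u : Finset ℕ} (Q : ℕ → Quadrature (Fin d → S.D))
    {v : ℕ → Finset ℕ} (hv : Monotone v) (n : ℕ → ℕ) {m : ℕ} (hm : ¬u ⊆ v m) :
    S.componentForm u ((S.multilevel φ Q v n m).map fun p => (p.1, p.2.1)) = S.C₀ ^ u.card := by
  simp only [componentForm, eval_coe]
  rw [(isAnchored_prod_mean u).eval_multilevel_of_not_subset φ Q hv n hm]
  simp only [fun y => (isAnchored_prodKernel_left u y).eval_multilevel_of_not_subset φ Q hv n hm,
    eval_zero]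
  ring

/-- At lifted nodes the factor for `j ∈ u` reads the coordinate `φ j`; as `φ` is injective on `u`,
reindexing the products turns `K_u` into `K_{φ(u)}`. -/
theorem componentForm_multilevel_of_subset {u : Finset ℕ} (hφ : Set.InjOn φ (u : Set ℕ))
    (Q : ℕ → Quadrature (Fin d → S.D)) {v : ℕ → Finset ℕ} (hv : Monotone v) (n : ℕ → ℕ)
    {k m : ℕ} (hk : k < m) (h1 : ¬u ⊆ v k) (h2 : u ⊆ v (k + 1)) :
    S.componentForm u ((S.multilevel φ Q v n m).map fun p => (p.1, p.2.1)) =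
      S.componentForm (u.image φ) (Q (n (k + 1))) := by
  simp only [componentForm, eval_coe]
  rw [(isAnchored_prod_mean u).eval_multilevel_of_subset φ Q hv n hk h1 h2]
  simp only [fun y => (isAnchored_prodKernel_left u y).eval_multilevel_of_subset φ Q hv n hk h1 h2]
  rw [(IsAnchored.eval (Q (n (k + 1))) (F := fun t y => S.prodKernel u (fun j => t (φ j)) y)
    fun t => isAnchored_prodKernel_right u _).eval_multilevel_of_subset φ Q hv n hk h1 h2]
  simp only [prodKernel, Finset.prod_image hφ, Finset.card_image_of_injOn hφ]

end Univariate

namespace Univariate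

variable {S : Univariate}

/-! ### The nested cost of the multilevel algorithm -/

theorem pointCost_le (price : ℕ → ℝ≥0) (w : ℕ → Finset ℕ) (x : S.AdmissiblePoint) (i : ℕ)
    (h : ∀ j, j ∉ w i → x.1 j = S.c) : S.pointCost price w x ≤ price (w i).card :=
  iInf₂_le i h

theorem sum_map_le_length_mul {X : Type} (l : List X) (f : X → ℝ≥0∞) (b : ℝ≥0∞)
    (h : ∀ x ∈ l, f x ≤ b) : (l.map f).sum ≤ l.length * b := by
  induction l with
  | nil => simp
  | cons x l ih =>
    rw [List.map_cons, List.sum_cons, List.length_cons, Nat.cast_succ, add_mul, one_mul, add_comm]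
    exact add_le_add (ih fun y hy => h y (List.mem_cons_of_mem _ hy)) (h x List.mem_cons_self)

/-- A strictly increasing sequence whose first `m + 1` sets contain the sets `v 0, …, v m`. -/
theorem exists_strictMono_superset {v : ℕ → Finset ℕ} (hv : Monotone v) (m : ℕ) :
    ∃ w : ℕ → Finset ℕ, StrictMono w ∧ ∀ k ≤ m, v k ⊆ w k ∧ (w k).card ≤ (v k).card + k := by
  obtain ⟨N, hN⟩ : ∃ N, ∀ j ∈ v m, j < N :=
    ⟨(v m).sup id + 1, fun j hj => Nat.lt_succ_of_le (Finset.le_sup (f := id) hj)⟩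
  -- The sets `v k` may repeat, so one fresh coordinate beyond all of `v m` is added per step to
  -- make the sequence strict.
  refine ⟨fun k => v (min k m) ∪ Finset.Ico N (N + k), strictMono_nat_of_lt_succ fun k => ?_,
    fun k hk => ?_⟩
  · refine (Finset.ssubset_iff_of_subset ?_).mpr ⟨N + k, ?_, ?_⟩
    · exact Finset.union_subset_union (hv (by omega)) (Finset.Ico_subset_Ico_right (by omega))
    · simp
    · simp only [Finset.mem_union, Finset.mem_Ico, lt_irrefl, and_false, or_false]
      intro h
      have := hN _ (hv (min_le_right k m) h)
      omega
  · simp only [min_eq_left hk]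
    exact ⟨Finset.subset_union_left, (Finset.card_union_le _ _).trans (by simp)⟩

/-- Level `k` uses `2 n_k` points, all anchored outside `v_k`. The extra `k` in the price pays for
the padding that makes the nested sequence strict. -/
theorem nestedCost_multilevel_le {d : ℕ} (φ : ℕ → Fin d) (price : ℕ → ℝ≥0)
    (hprice : Monotone price) (Q : ℕ → Quadrature (Fin d → S.D))
    (hQ : ∀ n, 1 ≤ n → (Q n).length = n) {v : ℕ → Finset ℕ} (hv : Monotone v) (hv0 : v 0 = ∅)
    {n : ℕ → ℕ} (hn : ∀ k, 1 ≤ n k) (m : ℕ) :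
    S.nestedCost price (S.multilevel φ Q v n m) ≤
      ((price 0 + ∑ i ∈ Finset.range m,
        2 * n (i + 1) * price ((v (i + 1)).card + (i + 1)) : ℝ≥0) : ℝ≥0∞) := by
  obtain ⟨w, hw, hvw⟩ := exists_strictMono_superset hv m
  refine iInf₂_le_of_le w hw ?_
  rw [multilevel, List.map_cons, List.sum_cons, ENNReal.coe_add]
  refine add_le_add ?_ ?_
  · refine (pointCost_le price w _ 0 fun j _ => ?_).trans ?_
    · exact S.restrict_apply_of_notMem (Finset.notMem_empty j) _
    -- The set `w 0` is empty, so the evaluation at the anchor costs `price 0`.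
    · have := (hvw 0 (Nat.zero_le m)).2
      rw [hv0, Finset.card_empty, Nat.le_zero] at this
      rw [this]
  · have key : ∀ l ≤ m, (((List.range l).flatMap fun i =>
        S.difference (S.lift φ (Q (n (i + 1))) (v (i + 1))) (v i)).map fun p =>
          S.pointCost price w p.2).sum ≤ ((∑ i ∈ Finset.range l,
        2 * n (i + 1) * price ((v (i + 1)).card + (i + 1)) : ℝ≥0) : ℝ≥0∞) := by
      intro l
      induction l with
      | zero => simp
      | succ l ih =>
        intro hl
        rw [List.range_succ, List.flatMap_append, List.map_append, List.sum_append,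
          Finset.sum_range_succ, ENNReal.coe_add]
        refine add_le_add (ih (by omega)) ?_
        rw [List.flatMap_singleton]
        have hp : (price (w (l + 1)).card : ℝ≥0∞) ≤ price ((v (l + 1)).card + (l + 1)) :=
          ENNReal.coe_le_coe.mpr (hprice (hvw (l + 1) hl).2)
        refine (sum_map_le_length_mul _ _ (price ((v (l + 1)).card + (l + 1))) ?_).trans
          (le_of_eq ?_)
        · intro p hmem
          refine (pointCost_le price w _ (l + 1) fun j hj => ?_).trans hp
          have hj1 : j ∉ v (l + 1) := fun h => hj ((hvw (l + 1) hl).1 h)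
          have hj0 : j ∉ v l := fun h => hj1 (hv (Nat.le_succ l) h)
          rcases List.mem_append.mp hmem with h | h
          · obtain ⟨q, _, rfl⟩ := List.mem_map.mp h
            exact S.restrict_apply_of_notMem hj1 _
          · obtain ⟨q, _, rfl⟩ := List.mem_map.mp h
            exact S.restrict_apply_of_notMem hj0 _
        · simp only [difference, lift, List.length_append, List.length_map, hQ _ (hn (l + 1))]
          push_cast
          ring
    exact key m le_rfl

theorem nestedCost_nil (price : ℕ → ℝ≥0) : S.nestedCost price [] = 0 := by
  obtain ⟨w, hw, _⟩ := exists_strictMono_superset (v := fun _ => ∅) monotone_const 0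
  exact le_antisymm (iInf₂_le_of_le w hw (by simp)) bot_le

end Univariate

/-! ### The levels -/

theorem levelSize_zero (L : ℕ) (a : ℝ) : levelSize L a 0 = 0 := if_pos rfl

theorem levelSize_succ (L : ℕ) (a : ℝ) (k : ℕ) : levelSize L a (k + 1) = L * ⌈a ^ k⌉₊ := by
  simp [levelSize]

theorem levelSize_mono (L : ℕ) {a : ℝ} (ha : 1 < a) : Monotone (levelSize L a) := by
  refine monotone_nat_of_le_succ fun k => ?_
  cases k with
  | zero => simp [levelSize_zero]
  | succ k =>
    rw [levelSize_succ, levelSize_succ]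
    exact Nat.mul_le_mul_left _ (Nat.ceil_le_ceil (pow_le_pow_right₀ ha.le (Nat.le_succ k)))

/-- The summand `1` covers `k = 0`, where the level size is `0`. -/
theorem le_levelSize {L : ℕ} (hL : 1 ≤ L) {a : ℝ} (ha : 1 < a) (k : ℕ) :
    a ^ k / a ≤ (levelSize L a k : ℝ) + 1 := by
  have ha0 : 0 < a := by linarith
  rw [div_le_iff₀ ha0]
  cases k with
  | zero => simp [levelSize_zero, ha.le]
  | succ k =>
    rw [pow_succ, levelSize_succ]
    refine mul_le_mul_of_nonneg_right ?_ ha0.le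
    have h1 : a ^ k ≤ (⌈a ^ k⌉₊ : ℝ) := Nat.le_ceil _
    have h2 : (⌈a ^ k⌉₊ : ℝ) ≤ ((L * ⌈a ^ k⌉₊ : ℕ) : ℝ) :=
      Nat.cast_le.mpr (Nat.le_mul_of_pos_left _ hL)
    linarith

theorem levelSize_le (L : ℕ) {a : ℝ} (ha : 1 < a) (k : ℕ) :
    (levelSize L a k : ℝ) ≤ 2 * L * a ^ k := by
  cases k with
  | zero => simp [levelSize_zero]
  | succ k =>
    rw [levelSize_succ, Nat.cast_mul]
    have h1 : (1 : ℝ) ≤ a ^ k := one_le_pow₀ ha.le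
    have h2 : (⌈a ^ k⌉₊ : ℝ) < a ^ k + 1 := Nat.ceil_lt_add_one (by positivity)
    have h3 : a ^ k ≤ a ^ (k + 1) := pow_le_pow_right₀ ha.le (Nat.le_succ k)
    have : (L : ℝ) * ⌈a ^ k⌉₊ ≤ L * (2 * a ^ (k + 1)) :=
      mul_le_mul_of_nonneg_left (by linarith) (Nat.cast_nonneg L)
    linarith

theorem levelSet_zero (u : ℕ → Finset ℕ) (L : ℕ) (a : ℝ) : levelSet u L a 0 = ∅ := by
  simp [levelSet, levelSize_zero]

theorem levelSet_mono (u : ℕ → Finset ℕ) (L : ℕ) {a : ℝ} (ha : 1 < a) :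
    Monotone (levelSet u L a) := fun _ _ hkl =>
  Finset.biUnion_subset_biUnion_of_subset_left _
    (Finset.Icc_subset_Icc_right (levelSize_mono L ha hkl))

theorem subset_levelSet (u : ℕ → Finset ℕ) (L : ℕ) (a : ℝ) {j k : ℕ} (hj : 1 ≤ j)
    (hjk : j ≤ levelSize L a k) : u j ⊆ levelSet u L a k :=
  Finset.subset_biUnion_of_mem u (Finset.mem_Icc.mpr ⟨hj, hjk⟩)

theorem card_levelSet_le (u : ℕ → Finset ℕ) (L : ℕ) (a : ℝ) {d : ℕ} (hd : ∀ j, (u j).card ≤ d)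
    (k : ℕ) : (levelSet u L a k).card ≤ d * levelSize L a k := by
  refine (Finset.card_biUnion_le_card_mul _ _ d fun j _ => hd j).trans ?_
  simp [mul_comm]

/-! ### Choice of the numbers of nodes -/

theorem sum_range_pow_le {x : ℝ} (h0 : 0 ≤ x) (h1 : x < 1) (m : ℕ) :
    ∑ i ∈ Finset.range m, x ^ i ≤ (1 - x)⁻¹ := by
  rw [← tsum_geometric_of_lt_one h0 h1]
  exact (summable_geometric_of_lt_one h0 h1).sum_le_tsum _ fun i _ => pow_nonneg h0 i

theorem sum_range_pow_succ_le {h : ℝ} (h1 : 1 < h) (m : ℕ) :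
    ∑ i ∈ Finset.range m, h ^ (i + 1) ≤ h / (h - 1) * h ^ m := by
  have hpos : 0 < h - 1 := by linarith
  simp only [pow_succ, ← Finset.sum_mul]
  rw [geom_sum_eq h1.ne', div_mul_eq_mul_div, div_mul_eq_mul_div]
  refine div_le_div_of_nonneg_right ?_ hpos.le
  nlinarith

/-- Numbers of levels and nodes that balance error and cost, in terms of `b = a^(r/2)` and `g = a^s`. -/
theorem exists_levels {b g τ p : ℝ} (hb : 1 < b) (hg : 0 < g) (hτ : 0 < τ) (hp : 0 < p)
    (hpτ : 1 < p * τ) (hgb : g < b ^ p) :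
    ∃ A₁ A₂ : ℝ, 0 < A₁ ∧ 0 < A₂ ∧ ∀ ε : ℝ, 0 < ε → ε ≤ 1 →
      ∃ (m : ℕ) (n : ℕ → ℕ), (∀ k, 1 ≤ n k) ∧ Antitone n ∧
        ∑ i ∈ Finset.range m, (n (i + 1) : ℝ) ^ (-(2 * τ)) * (b ^ i)⁻¹ ^ 2 + (b ^ m)⁻¹ ^ 2
          ≤ A₁ * ε ^ 2 ∧
        1 + ∑ i ∈ Finset.range m, n (i + 1) * g ^ (i + 1) ≤ A₂ * ε ^ (-p) := by
  have hb0 : 0 < b := by linarith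
  -- The surplus of the error exponent over `2`; it is positive exactly because `pτ > 1`, and it
  -- makes the error series geometric with ratio `x`.
  set θ := 2 * (p * τ) - 2 with hθ
  have hθ0 : 0 < θ := by linarith
  set h := b ^ p with hh
  have hh1 : 1 < h := Real.one_lt_rpow hb hp
  have hh0 : 0 < h := by linarith
  set x := b ^ (-θ) with hx
  have hx0 : 0 < x := Real.rpow_pos_of_pos hb0 _
  have hx1 : x < 1 := Real.rpow_lt_one_of_one_lt_of_neg hb (by linarith)
  have hgh0 : 0 < g / h := by positivity
  have hgh1 : g / h < 1 := (div_lt_one hh0).mpr hgb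
  have hx' : 0 < (1 - x)⁻¹ := inv_pos.mpr (by linarith)
  have hgh' : 0 < (1 - g / h)⁻¹ := inv_pos.mpr (by linarith)
  have hhm : 0 < h / (h - 1) := div_pos hh0 (by linarith)
  refine ⟨b ^ 2 * (b ^ θ * (1 - x)⁻¹) + 1, 1 + ((1 - g / h)⁻¹ + h / (h - 1) * h), by positivity,
    by positivity, fun ε hε hε1 => ?_⟩
  -- Here `b^m₀ ≤ 1/ε < b^(m₀+1)`, so `m = m₀ + 1` is the first level with truncation error below
  -- `ε`, and `b^m` overshoots `1/ε` by at most the factor `b`.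
  obtain ⟨m₀, hm₀, hm₁⟩ := exists_nat_pow_near (one_le_inv_iff₀.mpr ⟨hε, hε1⟩) hb
  set m := m₀ + 1 with hm
  have hbm : b ^ m ≤ b * ε⁻¹ := by
    rw [hm, pow_succ, mul_comm]
    exact mul_le_mul_of_nonneg_left hm₀ hb0.le
  have hεm : (b ^ m)⁻¹ ≤ ε := inv_le_of_inv_le₀ hε hm₁.le
  have hεp : 1 ≤ ε ^ (-p) := Real.one_le_rpow_of_pos_of_le_one_of_nonpos hε hε1 (by linarith)
  set N : ℕ → ℝ := fun k => ((b ^ k)⁻¹ * ε⁻¹) ^ p with hN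
  have hbase : ∀ k, 0 < (b ^ k)⁻¹ * ε⁻¹ := fun k => by positivity
  have hN0 : ∀ k, 0 < N k := fun k => Real.rpow_pos_of_pos (hbase k) p
  refine ⟨m, fun k => ⌈N k⌉₊, fun k => Nat.ceil_pos.mpr (hN0 k), fun k l hkl => ?_, ?_, ?_⟩
  · refine Nat.ceil_le_ceil (Real.rpow_le_rpow (hbase l).le ?_ hp.le)
    exact mul_le_mul_of_nonneg_right
      (inv_anti₀ (by positivity) (pow_le_pow_right₀ hb.le hkl)) (by positivity)
  -- With `y = b^(i+1) ε` the node factor is at most `y^(2pτ) = y^θ y²`. The factor `y²` cancels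
  -- `b^(-2i)` up to `b² ε²`, and `y^θ` decays geometrically going down from the last level.
  · have hterm : ∀ i ∈ Finset.range m, (⌈N (i + 1)⌉₊ : ℝ) ^ (-(2 * τ)) * (b ^ i)⁻¹ ^ 2 ≤
        b ^ 2 * b ^ θ * ε ^ 2 * x ^ (m - 1 - i) := by
      intro i hi
      have hi := Finset.mem_range.mp hi
      set y := b ^ (i + 1) * ε with hy
      have hy0 : 0 < y := by positivity
      have h1 : (⌈N (i + 1)⌉₊ : ℝ) ^ (-(2 * τ)) ≤ y ^ θ * y ^ 2 := by
        refine (Real.rpow_le_rpow_of_nonpos (hN0 _) (Nat.le_ceil _) (by linarith)).trans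
          (le_of_eq ?_)
        rw [hN]
        simp only
        rw [← mul_inv, ← hy, Real.inv_rpow hy0.le, ← Real.rpow_neg hy0.le, ← Real.rpow_mul hy0.le,
          ← Real.rpow_natCast y 2, ← Real.rpow_add hy0]
        congr 1
        rw [hθ]
        push_cast
        ring
      have h2 : y ^ θ ≤ b ^ θ * x ^ (m - 1 - i) := by
        have hy1 : y ≤ b * (b ^ (m - 1 - i))⁻¹ := by
          rw [hy, ← div_eq_mul_inv, le_div_iff₀ (by positivity)]
          calc b ^ (i + 1) * ε * b ^ (m - 1 - i) = b ^ m * ε := by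
                rw [mul_right_comm, ← pow_add]; congr 2; omega
            _ ≤ b * ε⁻¹ * ε := mul_le_mul_of_nonneg_right hbm hε.le
            _ = b := by field_simp
        refine (Real.rpow_le_rpow hy0.le hy1 hθ0.le).trans (le_of_eq ?_)
        rw [Real.mul_rpow hb0.le (by positivity), hx, Real.inv_rpow (by positivity),
          Real.rpow_neg hb0.le, inv_pow, ← Real.rpow_natCast, ← Real.rpow_natCast,
          ← Real.rpow_mul hb0.le, ← Real.rpow_mul hb0.le, mul_comm θ]
      calc (⌈N (i + 1)⌉₊ : ℝ) ^ (-(2 * τ)) * (b ^ i)⁻¹ ^ 2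
          ≤ (b ^ θ * x ^ (m - 1 - i) * y ^ 2) * (b ^ i)⁻¹ ^ 2 :=
            mul_le_mul_of_nonneg_right (h1.trans (mul_le_mul_of_nonneg_right h2 (sq_nonneg y)))
              (sq_nonneg _)
        _ = b ^ 2 * b ^ θ * ε ^ 2 * x ^ (m - 1 - i) := by
            rw [hy]
            field_simp
            ring
    have hsum := Finset.sum_le_sum hterm
    rw [← Finset.mul_sum, Finset.sum_range_reflect (fun i => x ^ i) m] at hsum
    have h3 := mul_le_mul_of_nonneg_left (sum_range_pow_le hx0.le hx1 m)
      (by positivity : 0 ≤ b ^ 2 * b ^ θ * ε ^ 2)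
    have h4 : (b ^ m)⁻¹ ^ 2 ≤ ε ^ 2 := pow_le_pow_left₀ (by positivity) hεm 2
    linarith
  -- The main part `N` gives a geometric series with ratio `g / h < 1`. Rounding up adds at most
  -- `g^(i+1) ≤ h^(i+1)`, whose sum is of order `h^m`, hence of order `ε^(-p)`.
  · have hterm : ∀ i ∈ Finset.range m, (⌈N (i + 1)⌉₊ : ℝ) * g ^ (i + 1) ≤
        ε ^ (-p) * (g / h) ^ i + h ^ (i + 1) := by
      intro i _
      have h1 : (⌈N (i + 1)⌉₊ : ℝ) ≤ N (i + 1) + 1 := (Nat.ceil_lt_add_one (hN0 _).le).le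
      have h2 : N (i + 1) = ε ^ (-p) * (h ^ (i + 1))⁻¹ := by
        rw [hN]
        simp only
        rw [Real.mul_rpow (by positivity) (by positivity), Real.inv_rpow hε.le,
          Real.inv_rpow (by positivity), Real.rpow_neg hε.le, mul_comm, hh,
          ← Real.rpow_natCast, ← Real.rpow_natCast, ← Real.rpow_mul hb0.le,
          ← Real.rpow_mul hb0.le, mul_comm p]
      have h3 : g ^ (i + 1) ≤ h ^ (i + 1) := pow_le_pow_left₀ hg.le hgb.le _
      have h4 : (g / h) ^ (i + 1) ≤ (g / h) ^ i :=
        pow_le_pow_of_le_one hgh0.le hgh1.le (Nat.le_succ i)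
      calc (⌈N (i + 1)⌉₊ : ℝ) * g ^ (i + 1) ≤ (N (i + 1) + 1) * g ^ (i + 1) :=
            mul_le_mul_of_nonneg_right h1 (by positivity)
        _ = ε ^ (-p) * (g / h) ^ (i + 1) + g ^ (i + 1) := by
            rw [h2, div_pow]; ring
        _ ≤ _ := add_le_add (mul_le_mul_of_nonneg_left h4 (by positivity)) h3
    have hsum := Finset.sum_le_sum hterm
    rw [Finset.sum_add_distrib, ← Finset.mul_sum] at hsum
    have h5 := mul_le_mul_of_nonneg_left (sum_range_pow_le hgh0.le hgh1 m)
      (by positivity : 0 ≤ ε ^ (-p))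
    have h6 : h ^ m ≤ h * ε ^ (-p) := by
      have := Real.rpow_le_rpow (by positivity) hbm hp.le
      rw [Real.mul_rpow hb0.le (by positivity), Real.inv_rpow hε.le, ← Real.rpow_neg hε.le,
        ← Real.rpow_natCast, ← Real.rpow_mul hb0.le, mul_comm (m : ℝ), Real.rpow_mul hb0.le,
        Real.rpow_natCast] at this
      exact this
    have h7 := (sum_range_pow_succ_le hh1 m).trans (mul_le_mul_of_nonneg_left h6 hhm.le)
    linarith

/-! ### Decay of the weights and convergence of the quadratures -/

namespace Weights

variable {S : Univariate} (W : Weights S)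

theorem hat_nonneg (v : Finset ℕ) : 0 ≤ W.hat v :=
  mul_nonneg (W.nonneg v) (pow_nonneg S.C₀_pos.le _)

theorem orderedHat_nonneg (u : ℕ → Finset ℕ) (j : ℕ) : 0 ≤ W.orderedHat u j := by
  unfold orderedHat
  split_ifs
  exacts [le_rfl, W.hat_nonneg _]

/-- Some `q > r + 1` has `γ̂_{u_j} = O(j^(-q))`. Writing `j^(-q) = j^(-r) j^(-(q-r))`, the first
factor is at most `(N+1)^(-r)` on the tail and the second is summable. -/
theorem exists_tail_bound (u : ℕ → Finset ℕ) {r : ℝ} (hr : 0 < r)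
    (hdecay : ((r + 1 : ℝ) : EReal) < W.decay u) :
    ∃ c : ℝ, 0 < c ∧ ∀ N : ℕ,
      Summable (fun j => if N < j then W.orderedHat u j else 0) ∧
      ∑' j, (if N < j then W.orderedHat u j else 0) ≤ c * ((N : ℝ) + 1) ^ (-r) := by
  obtain ⟨q, hq⟩ := lt_iSup_iff.mp hdecay
  obtain ⟨hlim, hrq⟩ := lt_iSup_iff.mp hq
  have hrq : r + 1 < q := EReal.coe_lt_coe_iff.mp hrq
  obtain ⟨b, hb⟩ := (Metric.isBounded_range_of_tendsto _ hlim).bddAbove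
  have hb : ∀ j : ℕ, W.orderedHat u j * (j : ℝ) ^ q ≤ b := fun j => hb ⟨j, rfl⟩
  have hZ : Summable fun j : ℕ => (j : ℝ) ^ (-(q - r)) :=
    Real.summable_nat_rpow.mpr (by linarith)
  set Z := ∑' j : ℕ, (j : ℝ) ^ (-(q - r)) with hZdef
  have hZ0 : 0 ≤ Z := tsum_nonneg fun j => Real.rpow_nonneg (Nat.cast_nonneg j) _
  have hle : ∀ N j : ℕ, (if N < j then W.orderedHat u j else 0) ≤
      |b| * ((N : ℝ) + 1) ^ (-r) * (j : ℝ) ^ (-(q - r)) := by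
    intro N j
    split_ifs with h
    · have hj : (0 : ℝ) < j := Nat.cast_pos.mpr (by omega)
      have hNj : (N : ℝ) + 1 ≤ j := by exact_mod_cast h
      have h1 : W.orderedHat u j ≤ |b| * (j : ℝ) ^ (-q) := by
        rw [Real.rpow_neg hj.le, ← div_eq_mul_inv, le_div_iff₀ (Real.rpow_pos_of_pos hj q)]
        exact (hb j).trans (le_abs_self b)
      have h2 : (j : ℝ) ^ (-q) = (j : ℝ) ^ (-r) * (j : ℝ) ^ (-(q - r)) := by
        rw [← Real.rpow_add hj]; congr 1; ring
      have h3 : (j : ℝ) ^ (-r) ≤ ((N : ℝ) + 1) ^ (-r) :=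
        Real.rpow_le_rpow_of_nonpos (by positivity) hNj (by linarith)
      rw [h2] at h1
      refine h1.trans ?_
      rw [mul_assoc]
      gcongr
    · positivity
  refine ⟨|b| * Z + 1, by positivity, fun N => ?_⟩
  have hs : Summable fun j : ℕ => |b| * ((N : ℝ) + 1) ^ (-r) * (j : ℝ) ^ (-(q - r)) :=
    hZ.mul_left _
  have hnn : ∀ j, 0 ≤ (if N < j then W.orderedHat u j else 0) := fun j => by
    split_ifs
    exacts [W.orderedHat_nonneg u j, le_rfl]
  have hsum := Summable.of_nonneg_of_le hnn (hle N) hs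
  refine ⟨hsum, (hsum.tsum_le_tsum (hle N) hs).trans ?_⟩
  rw [tsum_mul_left, ← hZdef]
  have : 0 ≤ ((N : ℝ) + 1) ^ (-r) := by positivity
  nlinarith

end Weights

theorem exists_one_add_log_rpow_le {β δ : ℝ} (hβ : 0 ≤ β) (hδ : 0 < δ) :
    ∃ c : ℝ, 0 < c ∧ ∀ x : ℝ, 1 ≤ x → (1 + Real.log x) ^ β ≤ c * x ^ δ := by
  -- The exponent `β` is raised to `β + 1` to avoid division by zero when `β = 0`.
  set η := δ / (β + 1) with hη
  have hη0 : 0 < η := by positivity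
  refine ⟨(1 + 1 / η) ^ (β + 1), by positivity, fun x hx => ?_⟩
  have hlog : 0 ≤ Real.log x := Real.log_nonneg hx
  have h1 : 1 ≤ x ^ η := Real.one_le_rpow hx hη0.le
  have h2 : Real.log x ≤ x ^ η / η := Real.log_le_rpow_div (by linarith) hη0
  have h3 : 1 + Real.log x ≤ (1 + 1 / η) * x ^ η := by
    rw [add_mul, one_mul, one_div, inv_mul_eq_div]
    linarith
  calc (1 + Real.log x) ^ β ≤ (1 + Real.log x) ^ (β + 1) :=
        Real.rpow_le_rpow_of_exponent_le (by linarith) (by linarith)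
    _ ≤ ((1 + 1 / η) * x ^ η) ^ (β + 1) := Real.rpow_le_rpow (by linarith) h3 (by linarith)
    _ = (1 + 1 / η) ^ (β + 1) * x ^ δ := by
        rw [Real.mul_rpow (by positivity) (by positivity), ← Real.rpow_mul (by linarith), hη,
          div_mul_cancel₀ _ (by linarith : β + 1 ≠ 0)]

namespace Univariate

variable {S : Univariate}

/-- Since `|e| ≤ d`, the powers of `C` and of the logarithm are bounded uniformly in `e`; the
logarithm is absorbed by lowering the rate from `α` to `τ`. -/
theorem exists_componentForm_bound {d : ℕ} {α τ c C β₁ β₂ : ℝ} (hτ : τ < α) (hc : 0 ≤ c)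
    (hC : 0 ≤ C) (hβ₁ : 0 ≤ β₁) (hβ₂ : 0 ≤ β₂) (hτ0 : 0 < τ)
    (Q : ℕ → Quadrature (Fin d → S.D))
    (hQ : ∀ n, 1 ≤ n → ∀ e : Finset (Fin d), S.componentError (Q n) e ≤
      ENNReal.ofReal (c * C ^ e.card * ((n : ℝ) + 1) ^ (-α) *
        (1 + Real.log ((n : ℝ) + 1)) ^ (β₁ * e.card + β₂))) :
    ∃ B : ℝ, 0 ≤ B ∧ ∀ n, 1 ≤ n → ∀ e : Finset (Fin d),
      S.componentForm e (Q n) ≤ B * (n : ℝ) ^ (-(2 * τ)) := by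
  obtain ⟨c₁, hc₁, hlog⟩ := exists_one_add_log_rpow_le
    (β := β₁ * d + β₂) (δ := α - τ) (by positivity) (by linarith)
  set C' := max 1 C with hC'
  refine ⟨(c * C' ^ d * c₁) ^ 2, sq_nonneg _, fun n hn e => ?_⟩
  have hn0 : (0 : ℝ) < n := Nat.cast_pos.mpr hn
  have hcard : e.card ≤ d := by simpa using e.card_le_univ
  have hx : (1 : ℝ) ≤ (n : ℝ) + 1 := by linarith
  have hx0 : (0 : ℝ) < (n : ℝ) + 1 := by linarith
  have hl : 0 ≤ Real.log ((n : ℝ) + 1) := Real.log_nonneg hx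
  have hR : c * C ^ e.card * ((n : ℝ) + 1) ^ (-α) *
      (1 + Real.log ((n : ℝ) + 1)) ^ (β₁ * e.card + β₂) ≤ c * C' ^ d * c₁ * (n : ℝ) ^ (-τ) := by
    have h1 : C ^ e.card ≤ C' ^ d :=
      (pow_le_pow_left₀ hC (le_max_right 1 C) _).trans
        (pow_le_pow_right₀ (le_max_left 1 C) hcard)
    have h2 : (1 + Real.log ((n : ℝ) + 1)) ^ (β₁ * e.card + β₂) ≤
        c₁ * ((n : ℝ) + 1) ^ (α - τ) := by
      refine (Real.rpow_le_rpow_of_exponent_le (by linarith) ?_).trans (hlog _ hx)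
      have : (e.card : ℝ) ≤ d := Nat.cast_le.mpr hcard
      nlinarith
    have h3 : ((n : ℝ) + 1) ^ (-α) * ((n : ℝ) + 1) ^ (α - τ) = ((n : ℝ) + 1) ^ (-τ) := by
      rw [← Real.rpow_add hx0]; congr 1; ring
    have h4 : ((n : ℝ) + 1) ^ (-τ) ≤ (n : ℝ) ^ (-τ) :=
      Real.rpow_le_rpow_of_nonpos hn0 (by linarith) (by linarith)
    calc _ ≤ c * C' ^ d * ((n : ℝ) + 1) ^ (-α) * (c₁ * ((n : ℝ) + 1) ^ (α - τ)) := by gcongr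
      _ = c * C' ^ d * c₁ * (((n : ℝ) + 1) ^ (-α) * ((n : ℝ) + 1) ^ (α - τ)) := by ring
      _ ≤ _ := by
        rw [h3]
        gcongr
  obtain ⟨hnn, heq⟩ := S.componentError_eq (Q n) e
  have hE := (hQ n hn e).trans (ENNReal.ofReal_le_ofReal hR)
  rw [heq, ENNReal.ofReal_le_ofReal_iff (by positivity)] at hE
  calc S.componentForm e (Q n) = √(S.componentForm e (Q n)) ^ 2 := (Real.sq_sqrt hnn).symm
    _ ≤ (c * C' ^ d * c₁ * (n : ℝ) ^ (-τ)) ^ 2 := pow_le_pow_left₀ (Real.sqrt_nonneg _) hE 2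
    _ = (c * C' ^ d * c₁) ^ 2 * (n : ℝ) ^ (-(2 * τ)) := by
        rw [mul_pow, ← Real.rpow_natCast (_ ^ (-τ)), ← Real.rpow_mul hn0.le]
        congr 2
        push_cast
        ring

end Univariate

theorem exists_price_bound {price : ℕ → ℝ≥0} {s : ℝ} (hs : 0 ≤ s)
    (hprice : (fun k : ℕ => (price k : ℝ)) =O[atTop] fun k : ℕ => (k : ℝ) ^ s) :
    ∃ c : ℝ, 0 < c ∧ ∀ k, (price k : ℝ) ≤ c * ((k : ℝ) + 1) ^ s := by
  obtain ⟨c, hc⟩ := hprice.bound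
  obtain ⟨N, hN⟩ := eventually_atTop.mp hc
  refine ⟨|c| + ∑ i ∈ Finset.range N, (price i : ℝ) + 1, by positivity, fun k => ?_⟩
  have hk : (1 : ℝ) ≤ ((k : ℝ) + 1) ^ s :=
    Real.one_le_rpow (by linarith [Nat.cast_nonneg (α := ℝ) k]) hs
  have hsum : 0 ≤ ∑ i ∈ Finset.range N, (price i : ℝ) := Finset.sum_nonneg fun i _ => (price i).2
  by_cases h : k < N
  · have h1 : (price k : ℝ) ≤ ∑ i ∈ Finset.range N, (price i : ℝ) :=
      Finset.single_le_sum (f := fun i => (price i : ℝ)) (fun i _ => (price i).2)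
        (Finset.mem_range.mpr h)
    have := abs_nonneg c
    nlinarith
  · have h1 := hN k (not_lt.mp h)
    have h2 : (k : ℝ) ^ s ≤ ((k : ℝ) + 1) ^ s :=
      Real.rpow_le_rpow (Nat.cast_nonneg k) (by linarith) hs
    have h0 : 0 ≤ (k : ℝ) ^ s := Real.rpow_nonneg (Nat.cast_nonneg k) s
    rw [Real.norm_of_nonneg (price k).coe_nonneg, Real.norm_of_nonneg h0] at h1
    have h3 : c * (k : ℝ) ^ s ≤ |c| * ((k : ℝ) + 1) ^ s :=
      mul_le_mul (le_abs_self c) h2 h0 (abs_nonneg c)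
    nlinarith

namespace Weights

variable {S : Univariate} {W : Weights S} {u : ℕ → Finset ℕ}

/-! ### The error of the multilevel algorithm -/

/-- Passes from sums over sets to sums over indices: restricted to indices with `u j ≠ ∅`, the
ordering is injective and its range contains the support of `f`. -/
theorem IsOrdering.tsum_le (hu : W.IsOrdering u) {f : Finset ℕ → ℝ} {G : ℕ → ℝ}
    (hf : Summable f) (hf0 : f ∅ = 0) (hfa : ∀ v, v ∉ W.active → f v = 0) (hG : Summable G)
    (hG0 : ∀ j, 0 ≤ G j) (hfG : ∀ j, 1 ≤ j → u j ≠ ∅ → f (u j) ≤ G j) :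
    ∑' v, f v ≤ ∑' j, G j := by
  let e : {j // u j ≠ ∅} → Finset ℕ := fun j => u j.1
  have he : Function.Injective e := fun i j h => Subtype.ext (hu.inj _ _ i.2 h)
  have hsupp : Function.support f ⊆ Set.range e := fun v hv => by
    have hv0 : v ≠ ∅ := fun h => hv (h ▸ hf0)
    have hva : v ∈ W.active := by
      by_contra h
      exact hv (hfa v h)
    obtain ⟨j, rfl⟩ := hu.surj v hva hv0
    exact ⟨⟨j, hv0⟩, rfl⟩
  rw [← he.tsum_eq hsupp]
  refine Summable.tsum_le_tsum_of_inj Subtype.val Subtype.val_injective (fun j _ => hG0 j)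
    (fun j => hfG j.1 ?_ j.2) (hf.comp_injective he) hG
  refine Nat.one_le_iff_ne_zero.mpr fun h => j.2 ?_
  rw [h, hu.zero]

theorem IsOrdering.card_le (hu : W.IsOrdering u) {𝒲 : Set (Finset ℕ)} (h𝒲 : W.active ⊆ 𝒲) {d : ℕ}
    {φ : ℕ → Fin d} (hφ : IsColouring 𝒲 φ) (j : ℕ) : (u j).card ≤ d := by
  by_cases h : u j = ∅
  · simp [h]
  · rw [← Finset.card_image_of_injOn (hφ _ (h𝒲 (hu.mem_active j h)))]
    simpa using ((u j).image φ).card_le_univ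

/-- Bounded cardinality makes `γ` and `γ̂` comparable, although `C₀` may be less than `1`. -/
theorem γ_le_hat_mul {v : Finset ℕ} {d : ℕ} (hv : v.card ≤ d) :
    W.γ v ≤ W.hat v * max 1 S.C₀⁻¹ ^ d := by
  have h0 : S.C₀ ≠ 0 := S.C₀_pos.ne'
  have h1 : W.γ v = W.hat v * S.C₀⁻¹ ^ v.card := by
    rw [hat, mul_assoc, ← mul_pow, mul_inv_cancel₀ h0, one_pow, mul_one]
  rw [h1]
  refine mul_le_mul_of_nonneg_left ?_ (W.hat_nonneg v)
  exact (pow_le_pow_left₀ (inv_nonneg.mpr S.C₀_pos.le) (le_max_right 1 _) _).trans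
    (pow_le_pow_right₀ (le_max_left 1 _) hv)

theorem IsOrdering.tsum_multilevel_le (hu : W.IsOrdering u) {𝒲 : Set (Finset ℕ)}
    (h𝒲 : W.active ⊆ 𝒲) {d : ℕ} {φ : ℕ → Fin d} (hφ : IsColouring 𝒲 φ)
    (Q : ℕ → Quadrature (Fin d → S.D)) {B τ : ℝ} (hB : 0 ≤ B)
    (hQ : ∀ n, 1 ≤ n → ∀ e : Finset (Fin d),
      S.componentForm e (Q n) ≤ B * (n : ℝ) ^ (-(2 * τ)))
    {L : ℕ} {a : ℝ} (ha : 1 < a) {T : ℕ → ℝ}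
    (hT : ∀ N : ℕ, Summable (fun j => if N < j then W.orderedHat u j else 0) ∧
      ∑' j, (if N < j then W.orderedHat u j else 0) ≤ T N)
    {n : ℕ → ℕ} (hn : ∀ k, 1 ≤ n k) (m : ℕ) :
    ∑' v, W.γ v * S.componentForm v
        ((S.multilevel φ Q (levelSet u L a) n m).map fun p => (p.1, p.2.1)) ≤
      ∑ i ∈ Finset.range m, max 1 S.C₀⁻¹ ^ d * B * (n (i + 1) : ℝ) ^ (-(2 * τ)) *
        T (levelSize L a i) + T (levelSize L a m) := by
  set c₁ := max 1 S.C₀⁻¹ ^ d with hc₁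
  have hc₁0 : 0 ≤ c₁ := pow_nonneg (zero_le_one.trans (le_max_left 1 _)) _
  set t : ℕ → ℕ → ℝ := fun N j => if N < j then W.orderedHat u j else 0 with ht
  have ht0 : ∀ N j, 0 ≤ t N j := fun N j => by
    simp only [ht]
    split_ifs
    exacts [W.orderedHat_nonneg u j, le_rfl]
  set b : ℕ → ℝ := fun i => c₁ * B * (n (i + 1) : ℝ) ^ (-(2 * τ)) with hb
  have hb0 : ∀ i, 0 ≤ b i := fun i => by positivity
  have hmono := levelSet_mono u L ha
  -- Index `j` is charged to every level `i` with `L_i < j`. Only the level before `u_j` first fits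
  -- is needed; the other terms are nonnegative, and summing over `j` yields the tails.
  set G : ℕ → ℝ := fun j =>
    ∑ i ∈ Finset.range m, b i * t (levelSize L a i) j + t (levelSize L a m) j with hG
  have hs : ∀ i ∈ Finset.range m, Summable fun j => b i * t (levelSize L a i) j :=
    fun i _ => (hT _).1.mul_left _
  have hGs : Summable G := (summable_sum hs).add (hT _).1
  have hterm : ∀ j, ∀ i ∈ Finset.range m, 0 ≤ b i * t (levelSize L a i) j :=
    fun j i _ => mul_nonneg (hb0 i) (ht0 _ j)
  have hlt : ∀ j k, 1 ≤ j → ¬u j ⊆ levelSet u L a k → levelSize L a k < j :=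
    fun j k hj h => not_le.mp fun hjk => h (subset_levelSet u L a hj hjk)
  refine (hu.tsum_le (W.hasSum_squaredError _).summable ?_ ?_ hGs
    (fun j => add_nonneg (Finset.sum_nonneg (hterm j)) (ht0 _ j)) ?_).trans ?_
  · rw [Univariate.componentForm_multilevel_empty, mul_zero]
  · intro v hv
    rw [show W.γ v = 0 from le_antisymm (not_lt.mp hv) (W.nonneg v), zero_mul]
  · intro j hj hju
    have hhat : W.orderedHat u j = W.hat (u j) := if_neg hju
    by_cases hm : u j ⊆ levelSet u L a m
    · classical
      have hex : ∃ k, u j ⊆ levelSet u L a k := ⟨m, hm⟩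
      obtain ⟨k, hk⟩ : ∃ k, Nat.find hex = k + 1 := by
        -- The first level that contains `u j` is not `0`, since `v_0 = ∅` and `u j` is non-empty.
        refine Nat.exists_eq_succ_of_ne_zero fun h0 => hju ?_
        have := Nat.find_spec hex
        rw [h0, levelSet_zero] at this
        exact Finset.subset_empty.mp this
      have hk2 : u j ⊆ levelSet u L a (k + 1) := hk ▸ Nat.find_spec hex
      have hk1 : ¬u j ⊆ levelSet u L a k := Nat.find_min hex (by omega)
      have hkm : k < m := by
        have := Nat.find_min' hex hm
        omega
      rw [Univariate.componentForm_multilevel_of_subset φ (hφ _ (h𝒲 (hu.mem_active j hju))) Q hmono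
        n hkm hk1 hk2]
      calc W.γ (u j) * S.componentForm ((u j).image φ) (Q (n (k + 1)))
          ≤ (W.hat (u j) * c₁) * (B * (n (k + 1) : ℝ) ^ (-(2 * τ))) :=
            mul_le_mul (γ_le_hat_mul (hu.card_le h𝒲 hφ j)) (hQ _ (hn _) _)
              (S.componentError_eq _ _).1 (mul_nonneg (W.hat_nonneg _) hc₁0)
        _ = b k * t (levelSize L a k) j := by
            simp only [ht, hb, if_pos (hlt j k hj hk1), hhat]
            ring
        _ ≤ ∑ i ∈ Finset.range m, b i * t (levelSize L a i) j :=
            Finset.single_le_sum (f := fun i => b i * t (levelSize L a i) j) (hterm j)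
              (Finset.mem_range.mpr hkm)
        _ ≤ G j := le_add_of_nonneg_right (ht0 _ j)
    · rw [Univariate.componentForm_multilevel_of_not_subset φ Q hmono n hm]
      have : W.γ (u j) * S.C₀ ^ (u j).card = t (levelSize L a m) j := by
        simp only [ht, if_pos (hlt j m hj hm), hhat]
        rfl
      rw [this]
      exact le_add_of_nonneg_left (Finset.sum_nonneg (hterm j))
  · rw [hG, (summable_sum hs).tsum_add (hT _).1, Summable.tsum_finsetSum hs]
    refine add_le_add (Finset.sum_le_sum fun i _ => ?_) (hT _).2
    rw [tsum_mul_left]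
    exact mul_le_mul_of_nonneg_left (hT _).2 (hb0 i)

/-! ### Main results -/

theorem IsOrdering.exists_multilevel (hu : W.IsOrdering u)
    {price : ℕ → ℝ≥0} (hprice_mono : Monotone price) {s : ℝ} (hs : 0 ≤ s)
    (hprice : (fun k : ℕ => (price k : ℝ)) =O[atTop] fun k : ℕ => (k : ℝ) ^ s)
    {𝒲 : Set (Finset ℕ)} (h𝒲 : W.active ⊆ 𝒲) {d : ℕ} {φ : ℕ → Fin d} (hφ : IsColouring 𝒲 φ)
    (Q : ℕ → Quadrature (Fin d → S.D)) (hQ_length : ∀ n, 1 ≤ n → (Q n).length = n)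
    {B τ r p : ℝ} (hB : 0 ≤ B) (hτ : 0 < τ) (hr : 0 < r)
    (hQ : ∀ n, 1 ≤ n → ∀ e : Finset (Fin d),
      S.componentForm e (Q n) ≤ B * (n : ℝ) ^ (-(2 * τ)))
    (hdecay : ((r + 1 : ℝ) : EReal) < W.decay u) (hp : 0 < p) (hpτ : 1 < p * τ)
    (hpr : 2 * s < p * r) {L : ℕ} {a : ℝ} (hL : 1 ≤ L) (ha : 1 < a) :
    ∃ A : ℝ, 0 < A ∧ ∀ ε : ℝ, 0 < ε → ε ≤ 1 →
      ∃ (m : ℕ) (n : ℕ → ℕ), (∀ k, 1 ≤ n k) ∧ Antitone n ∧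
        W.error (S.multilevel φ Q (levelSet u L a) n m) ≤ ENNReal.ofReal ε ∧
        S.nestedCost price (S.multilevel φ Q (levelSet u L a) n m)
          ≤ ENNReal.ofReal (A * ε ^ (-p)) := by
  have ha0 : 0 < a := by linarith
  obtain ⟨cT, hcT, hT⟩ := W.exists_tail_bound u hr hdecay
  obtain ⟨cP, hcP, hP⟩ := exists_price_bound hs hprice
  set b := a ^ (r / 2) with hb
  set g := a ^ s with hg
  have hb1 : 1 < b := Real.one_lt_rpow ha (by linarith)
  have hb0 : 0 < b := by linarith
  have hg0 : 0 < g := Real.rpow_pos_of_pos ha0 s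
  have hgb : g < b ^ p := by
    rw [hg, hb, ← Real.rpow_mul ha0.le]
    exact Real.rpow_lt_rpow_of_exponent_lt ha (by linarith)
  obtain ⟨A₁, A₂, hA₁, hA₂, hlev⟩ := exists_levels hb1 hg0 hτ hp hpτ hgb
  set c₁ := max 1 S.C₀⁻¹ ^ d with hc₁
  have hc₁0 : 0 ≤ c₁ := pow_nonneg (zero_le_one.trans (le_max_left 1 _)) _
  -- the error constant
  set E := (c₁ * B + 1) * (cT * a ^ r) with hE
  have hE0 : 0 < E := by positivity
  -- The tail beyond `L_k` is of order `a^(-rk) = (b^k)^(-2)`.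
  have hTk : ∀ k, cT * ((levelSize L a k : ℝ) + 1) ^ (-r) ≤ cT * a ^ r * (b ^ k)⁻¹ ^ 2 := by
    intro k
    rw [mul_assoc]
    refine mul_le_mul_of_nonneg_left ?_ hcT.le
    refine (Real.rpow_le_rpow_of_nonpos (by positivity) (le_levelSize hL ha k)
      (by linarith)).trans (le_of_eq ?_)
    rw [Real.div_rpow (by positivity) ha0.le, Real.rpow_neg ha0.le r, div_inv_eq_mul, mul_comm,
      hb, inv_pow, ← pow_mul, ← Real.rpow_natCast (a ^ (r / 2)), ← Real.rpow_mul ha0.le,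
      Real.rpow_neg (by positivity), ← Real.rpow_natCast a k, ← Real.rpow_mul ha0.le]
    congr 3
    push_cast
    ring
  -- The levels are chosen for `ε / D`, which absorbs the error constant; `D ≥ 1` keeps `ε / D ≤ 1`.
  set D := max 1 √(E * A₁) with hD
  have hD1 : 1 ≤ D := le_max_left _ _
  have hD0 : 0 < D := by linarith
  have hED : E * A₁ ≤ D ^ 2 := by
    rw [← Real.sq_sqrt (by positivity : 0 ≤ E * A₁)]
    exact pow_le_pow_left₀ (Real.sqrt_nonneg _) (le_max_right _ _) 2
  -- the cost constant
  set c₄ := 2 * (d * L : ℝ) + (a - 1)⁻¹ + 1 with hc₄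
  have ha1 : 0 < a - 1 := by linarith
  have hc₄0 : 0 < c₄ := by positivity
  set F := 2 * (cP * c₄ ^ s) + price 0 with hF
  have hF0 : 0 < F := by positivity
  have hpr : ∀ k, (price ((levelSet u L a k).card + k) : ℝ) ≤ cP * c₄ ^ s * g ^ k := by
    intro k
    have h1 : (((levelSet u L a k).card + k : ℕ) : ℝ) + 1 ≤ c₄ * a ^ k := by
      have h2 : ((levelSet u L a k).card : ℝ) ≤ d * levelSize L a k := by
        exact_mod_cast card_levelSet_le u L a (hu.card_le h𝒲 hφ) k
      have h3 : (d : ℝ) * levelSize L a k ≤ d * (2 * L * a ^ k) :=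
        mul_le_mul_of_nonneg_left (levelSize_le L ha k) (Nat.cast_nonneg d)
      -- Bernoulli's inequality: the padding by `k` coordinates is dominated by `a^k`.
      have h4 : (k : ℝ) ≤ (a - 1)⁻¹ * a ^ k := by
        have := one_add_mul_le_pow (show -2 ≤ a - 1 by linarith) k
        rw [add_sub_cancel] at this
        rw [inv_mul_eq_div, le_div_iff₀ ha1]
        linarith
      have h5 : (1 : ℝ) ≤ a ^ k := one_le_pow₀ ha.le
      push_cast
      rw [hc₄]
      linarith
    calc (price ((levelSet u L a k).card + k) : ℝ)
        ≤ cP * ((((levelSet u L a k).card + k : ℕ) : ℝ) + 1) ^ s := hP _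
      _ ≤ cP * (c₄ * a ^ k) ^ s := by gcongr
      _ = cP * c₄ ^ s * g ^ k := by
          rw [Real.mul_rpow hc₄0.le (by positivity), hg, ← Real.rpow_natCast a k,
            ← Real.rpow_mul ha0.le, ← Real.rpow_natCast (a ^ s), ← Real.rpow_mul ha0.le,
            mul_comm s, mul_assoc]
  refine ⟨F * (A₂ * D ^ p), by positivity, fun ε hε hε1 => ?_⟩
  obtain ⟨m, n, hn, hanti, herr, hcost⟩ := hlev (ε / D) (by positivity)
    ((div_le_one hD0).mpr (hε1.trans hD1))
  refine ⟨m, n, hn, hanti, ?_, ?_⟩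
  · rw [W.error_eq_sqrt]
    refine ENNReal.ofReal_le_ofReal (Real.sqrt_le_iff.mpr ⟨hε.le, ?_⟩)
    refine (hu.tsum_multilevel_le h𝒲 hφ Q hB hQ ha hT hn m).trans ?_
    set σ := ∑ i ∈ Finset.range m, (n (i + 1) : ℝ) ^ (-(2 * τ)) * (b ^ i)⁻¹ ^ 2 with hσ
    have hσ0 : 0 ≤ σ := Finset.sum_nonneg fun i _ => by positivity
    have h1 : ∑ i ∈ Finset.range m, c₁ * B * (n (i + 1) : ℝ) ^ (-(2 * τ)) *
        (cT * ((levelSize L a i : ℝ) + 1) ^ (-r)) ≤ c₁ * B * (cT * a ^ r) * σ := by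
      rw [hσ, Finset.mul_sum]
      refine Finset.sum_le_sum fun i _ => ?_
      refine (mul_le_mul_of_nonneg_left (hTk i) (by positivity)).trans (le_of_eq ?_)
      ring
    calc _ ≤ c₁ * B * (cT * a ^ r) * σ + cT * a ^ r * (b ^ m)⁻¹ ^ 2 := add_le_add h1 (hTk m)
      _ ≤ E * (σ + (b ^ m)⁻¹ ^ 2) := by
          have h2 : 0 ≤ cT * a ^ r * σ := by positivity
          have h3 : 0 ≤ c₁ * B * (cT * a ^ r) * (b ^ m)⁻¹ ^ 2 := by positivity
          rw [hE]
          linarith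
      _ ≤ E * (A₁ * (ε / D) ^ 2) := mul_le_mul_of_nonneg_left herr hE0.le
      _ = E * A₁ * (ε ^ 2 / D ^ 2) := by rw [div_pow]; ring
      _ ≤ D ^ 2 * (ε ^ 2 / D ^ 2) := mul_le_mul_of_nonneg_right hED (by positivity)
      _ = ε ^ 2 := by field_simp
  · refine (Univariate.nestedCost_multilevel_le φ price hprice_mono Q hQ_length
      (levelSet_mono u L ha) (levelSet_zero u L a) hn m).trans ?_
    rw [← ENNReal.ofReal_coe_nnreal]
    refine ENNReal.ofReal_le_ofReal ?_
    push_cast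
    set σ := ∑ i ∈ Finset.range m, (n (i + 1) : ℝ) * g ^ (i + 1) with hσ
    have hσ0 : 0 ≤ σ := Finset.sum_nonneg fun i _ => by positivity
    have h1 : ∑ i ∈ Finset.range m, 2 * (n (i + 1) : ℝ) *
        (price ((levelSet u L a (i + 1)).card + (i + 1)) : ℝ) ≤ 2 * (cP * c₄ ^ s) * σ := by
      rw [hσ, Finset.mul_sum]
      refine Finset.sum_le_sum fun i _ => ?_
      refine (mul_le_mul_of_nonneg_left (hpr (i + 1)) (by positivity)).trans (le_of_eq ?_)
      ring
    have h2 : 0 ≤ cP * c₄ ^ s := by positivity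
    have h3 : 0 ≤ (price 0 : ℝ) * σ := mul_nonneg (price 0).coe_nonneg hσ0
    calc _ ≤ (price 0 : ℝ) + 2 * (cP * c₄ ^ s) * σ := add_le_add_right h1 _
      _ ≤ F * (1 + σ) := by rw [hF]; linarith
      _ ≤ F * (A₂ * (ε / D) ^ (-p)) := mul_le_mul_of_nonneg_left hcost hF0.le
      _ = F * (A₂ * D ^ p) * ε ^ (-p) := by
          rw [Real.div_rpow hε.le hD0.le, Real.rpow_neg hD0.le, div_inv_eq_mul]
          ring

/-! ### Complexity and the exponent of strong tractability -/

theorem complexity_anti (price : ℕ → ℝ≥0) {ε δ : ℝ} (h : ε ≤ δ) :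
    W.complexity price δ ≤ W.complexity price ε :=
  le_iInf₂ fun Q hQ => iInf₂_le Q (hQ.trans (ENNReal.ofReal_le_ofReal h))

/-- The exponent concerns all `ε > 0`. If `ε` is at least the initial error `e₀`, the zero algorithm
is free; for `1 < ε < e₀` the bound at `1` suffices after enlarging the constant by `max 1 e₀ ^ p`.
-/
theorem nestedExponent_le (price : ℕ → ℝ≥0) {p A : ℝ} (hp : 0 ≤ p) (hA : 0 ≤ A)
    (h : ∀ ε : ℝ, 0 < ε → ε ≤ 1 → W.complexity price ε ≤ ENNReal.ofReal (A * ε ^ (-p))) :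
    W.nestedExponent price ≤ (p : EReal) := by
  set e₀ := √(∑' u, W.γ u * S.componentForm u (([] : S.Algorithm).map fun p => (p.1, p.2.1)))
    with he₀
  have herr : W.error [] = ENNReal.ofReal e₀ := W.error_eq_sqrt []
  have hmax : 1 ≤ max 1 e₀ := le_max_left _ _
  have hmp : 1 ≤ max 1 e₀ ^ p := Real.one_le_rpow hmax hp
  refine iInf₂_le p ⟨hp, A * max 1 e₀ ^ p, by positivity, fun ε hε => ?_⟩
  rcases le_or_gt ε 1 with h1 | h1
  · refine (h ε hε h1).trans (ENNReal.ofReal_le_ofReal ?_)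
    refine mul_le_mul_of_nonneg_right ?_ (by positivity)
    exact le_mul_of_one_le_right hA hmp
  rcases le_or_gt e₀ ε with h2 | h2
  · refine (iInf₂_le ([] : S.Algorithm) (herr.trans_le (ENNReal.ofReal_le_ofReal h2))).trans ?_
    rw [Univariate.nestedCost_nil]
    exact bot_le
  · refine (complexity_anti price h1.le).trans ((h 1 one_pos le_rfl).trans
      (ENNReal.ofReal_le_ofReal ?_))
    rw [Real.one_rpow, mul_one, mul_assoc, Real.rpow_neg hε.le, ← div_eq_mul_inv]
    refine le_mul_of_one_le_right hA ((one_le_div (by positivity)).mpr ?_)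
    exact Real.rpow_le_rpow hε.le (h2.le.trans (le_max_right _ _)) hp

end Weights

theorem exists_exponent {δ : EReal} (hδ : 1 < δ) {s p : ℝ} (hs : 0 ≤ s) (hp : 0 < p)
    (h : ((2 * s : ℝ) : EReal) / (δ - 1) < (p : EReal)) :
    ∃ r : ℝ, 0 < r ∧ ((r + 1 : ℝ) : EReal) < δ ∧ 2 * s < p * r := by
  have h0 : 0 ≤ 2 * s / p := by positivity
  induction δ with
  | bot => exact absurd hδ (by simp)
  | top =>
    -- With infinite decay every `r` is allowed, so any value above `2s/p` serves.
    refine ⟨2 * s / p + 1, by linarith, EReal.coe_lt_top _, ?_⟩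
    rw [mul_add, mul_div_cancel₀ _ hp.ne']
    linarith
  | coe D =>
    have hD : 1 < D := by exact_mod_cast hδ
    have hD' : 0 < D - 1 := by linarith
    have h1 : 2 * s / (D - 1) < p := by
      rw [← EReal.coe_one, ← EReal.coe_sub, ← EReal.coe_div] at h
      exact_mod_cast h
    have h2 : 2 * s / p < D - 1 := by
      rw [div_lt_iff₀ hD'] at h1
      rw [div_lt_iff₀ hp]
      linarith
    obtain ⟨r, hr1, hr2⟩ := exists_between h2
    refine ⟨r, h0.trans_lt hr1, EReal.coe_lt_coe_iff.mpr (by linarith), ?_⟩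
    rw [div_lt_iff₀ hp] at hr1
    linarith

end InfDimIntegration

theorem mainTheorem6 (S : InfDimIntegration.Univariate) (W : InfDimIntegration.Weights S)
    -- the ordering of the non-empty active sets, and the decay of the weights
    (u : ℕ → Finset ℕ) (hu : W.IsOrdering u) (hdecay : 1 < W.decay u)
    -- the cost function
    (price : ℕ → ℝ≥0) (hprice_one : ∀ k, 1 ≤ price k) (hprice_mono : Monotone price)
    (s : ℝ) (hs : 0 ≤ s)
    (hprice : (fun k : ℕ => (price k : ℝ)) =O[atTop] fun k : ℕ => (k : ℝ) ^ s)
    -- finite algorithmic dimension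
    (𝒲 : Set (Finset ℕ)) (h𝒲 : W.active ⊆ 𝒲) (d : ℕ) (φ : ℕ → Fin d)
    (hφ : InfDimIntegration.IsColouring 𝒲 φ)
    -- the quadratures in dimension `d` and their convergence rate
    (α : ℝ) (hα : 0 < α)
    (Q : ℕ → InfDimIntegration.Quadrature (Fin d → S.D))
    (hQ_length : ∀ n, 1 ≤ n → (Q n).length = n)
    (c C β₁ β₂ : ℝ) (hc : 0 ≤ c) (hC : 0 ≤ C) (hβ₁ : 0 ≤ β₁) (hβ₂ : 0 ≤ β₂)
    (hQ : ∀ n, 1 ≤ n → ∀ e : Finset (Fin d), S.componentError (Q n) e ≤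
      ENNReal.ofReal (c * C ^ e.card * ((n : ℝ) + 1) ^ (-α) *
        (1 + Real.log ((n : ℝ) + 1)) ^ (β₁ * e.card + β₂))) :
    -- the multilevel algorithms achieve every exponent above the bound
    (∀ (L : ℕ) (a : ℝ), 1 ≤ L → 1 < a →
      ∀ p : ℝ, max ((1 / α : ℝ) : EReal) (((2 * s : ℝ) : EReal) / (W.decay u - 1)) < (p : EReal) →
        ∃ A : ℝ, 0 < A ∧ ∀ ε : ℝ, 0 < ε → ε ≤ 1 →
          ∃ (m : ℕ) (n : ℕ → ℕ), (∀ k, 1 ≤ n k) ∧ Antitone n ∧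
            W.error (S.multilevel φ Q (InfDimIntegration.levelSet u L a) n m)
              ≤ ENNReal.ofReal ε ∧
            S.nestedCost price (S.multilevel φ Q (InfDimIntegration.levelSet u L a) n m)
              ≤ ENNReal.ofReal (A * ε ^ (-p))) ∧
    -- the exponent of strong tractability
    W.nestedExponent price ≤
      max ((1 / α : ℝ) : EReal) (((2 * s : ℝ) : EReal) / (W.decay u - 1)) := by
  have key : ∀ (L : ℕ) (a : ℝ), 1 ≤ L → 1 < a →
      ∀ p : ℝ, max ((1 / α : ℝ) : EReal) (((2 * s : ℝ) : EReal) / (W.decay u - 1)) < (p : EReal) →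
        0 < p ∧ ∃ A : ℝ, 0 < A ∧ ∀ ε : ℝ, 0 < ε → ε ≤ 1 →
          ∃ (m : ℕ) (n : ℕ → ℕ), (∀ k, 1 ≤ n k) ∧ Antitone n ∧
            W.error (S.multilevel φ Q (InfDimIntegration.levelSet u L a) n m)
              ≤ ENNReal.ofReal ε ∧
            S.nestedCost price (S.multilevel φ Q (InfDimIntegration.levelSet u L a) n m)
              ≤ ENNReal.ofReal (A * ε ^ (-p)) := by
    intro L a hL ha p hp
    obtain ⟨hpα, hps⟩ := max_lt_iff.mp hp
    have hpα : 1 / α < p := EReal.coe_lt_coe_iff.mp hpα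
    have hp0 : 0 < p := (one_div_pos.mpr hα).trans hpα
    have hτ : 1 / p < α := (one_div_lt hα hp0).mp hpα
    obtain ⟨τ, hτ1, hτα⟩ := exists_between hτ
    have hτ0 : 0 < τ := (one_div_pos.mpr hp0).trans hτ1
    have hpτ : 1 < p * τ := by
      rw [div_lt_iff₀ hp0] at hτ1
      linarith
    obtain ⟨r, hr, hrd, hpr⟩ := InfDimIntegration.exists_exponent hdecay hs hp0 hps
    obtain ⟨B, hB, hQB⟩ := InfDimIntegration.Univariate.exists_componentForm_bound hτα hc hC hβ₁ hβ₂
      hτ0 Q hQ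
    exact ⟨hp0, hu.exists_multilevel hprice_mono hs hprice h𝒲 hφ Q hQ_length hB hτ0 hr hQB hrd hp0
      hpτ hpr hL ha⟩
  refine ⟨fun L a hL ha p hp => (key L a hL ha p hp).2, ?_⟩
  -- It suffices to bound the exponent by every real `p` above the maximum; the parameters `L = 1`
  -- and `a = 2` are one admissible choice.
  refine EReal.le_of_forall_lt_iff_le.mp fun p hp => ?_
  obtain ⟨hp0, A, hA, h⟩ := key 1 2 le_rfl one_lt_two p hp
  refine InfDimIntegration.Weights.nestedExponent_le price hp0.le hA.le fun ε hε hε1 => ?_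
  obtain ⟨m, n, _, _, herr, hcost⟩ := h ε hε hε1
  exact (iInf₂_le (f := fun (R : S.Algorithm) (_ : W.error R ≤ ENNReal.ofReal ε) =>
    S.nestedCost price R) _ herr).trans hcost
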